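/- Let $\rho\ge 2$, $s>1/2$, and let $l:\mathbb R\to\mathbb R$ be a measurable function such that, for some constants $c_1,c_2>0$, $c_1^2(1+\xi^2)^{\rho/2}\le l(\xi)\le c_2^2(1+\xi^2)^{\rho/2}$ for all $\xi\in\mathbb R$. Let $L$, $K=L^{1/2}$ and $\Lambda^{-1}$ be the Fourier multipliers in $x$ with symbols $l(\xi)$, $\sqrt{l(\xi)}$ and $|\xi|^{-1}$ (with the convention $\partial_x\leftrightarrow i\xi$), and write $\|\cdot\|$ for the norm of $L^2(\mathbb R)$. Let $g\in C^{\lfloor s\rfloor+1}(\mathbb R)$ be real-valued with $g(0)=0$, and put $G(p)=\int_0^p g(q)\,dq$. Let $T>0$ and let the real-valued function $u\in C([0,T),H^s(\mathbb R))\cap C^1([0,T),H^{s-1-\rho/2}(\mathbb R))$ be a solution (in the sense of distributions) of the Cauchy problem $$u_{tt}-Lu_{xx}=(g(u))_{xx}\quad (x\in\mathbb R,\ 0<t<T),\qquad u(\cdot,0)=\varphi,\quad u_t(\cdot,0)=\psi.$$ If $\Lambda^{-1}\psi\in L^2(\mathbb R)$, $K\varphi\in L^2(\mathbb R)$ and $G(\varphi)\in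 L^1(\mathbb R)$, then for every $t\in[0,T)$ one has $\Lambda^{-1}u_t(t)\in L^2(\mathbb R)$, $Ku(t)\in L^2(\mathbb R)$, $G(u(t))\in L^1(\mathbb R)$, and $$E(t)=\|\Lambda^{-1}u_t(t)\|^2+\|Ku(t)\|^2+2\int_{\mathbb R}G(u(x,t))\,dx=E(0).$$ -/

import Mathlib

open MeasureTheory Set TemperedDistribution FourierTransform
open scoped SchwartzMap

noncomputable section

namespace NonlocalWave

/-- The Hilbert space `L²(ℝ)` of complex-valued functions. -/
abbrev L2C : Type := Lp ℂ 2 (volume : Measure ℝ)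

/-- The Hilbert space `L²(ℝ)` of real-valued functions. -/
abbrev L2R : Type := Lp ℝ 2 (volume : Measure ℝ)

/-- The tempered distribution given by a real-valued `L²` function. -/
def toDist (v : L2R) : 𝓢'(ℝ, ℂ) :=
  ((Complex.ofRealCLM.compLp v : L2C) : 𝓢'(ℝ, ℂ))

/-- The tempered distribution `f` is (integration against) the function `F`. -/
def IsFunction (f : 𝓢'(ℝ, ℂ)) (F : ℝ → ℂ) : Prop :=
  ∀ θ : 𝓢(ℝ, ℂ), Integrable (fun x => θ x * F x) ∧ f θ = ∫ x, θ x * F x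

/-- `h = m(D) f`, the Fourier multiplier with symbol `m` applied to `f`: with the convention
`∂ₓ ↔ iξ`, the Fourier transform of `f` is a function `f̂(ξ)` and that of `h` is `m(ξ) f̂(ξ)`.
Mathlib's transform has the kernel `exp (-2πi x η)`, so that `ξ = 2πη`.
The symbol need not be smooth. -/
def IsMultiplier (m : ℝ → ℝ) (f h : 𝓢'(ℝ, ℂ)) : Prop :=
  ∃ F : ℝ → ℂ, IsFunction (𝓕 f) F ∧
    IsFunction (𝓕 h) (fun η => (m (2 * Real.pi * η) : ℂ) * F η)

/-- `m(D) f ∈ L²`. -/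
def MultiplierMemL2 (m : ℝ → ℝ) (f : 𝓢'(ℝ, ℂ)) : Prop :=
  ∃ w : L2C, IsMultiplier m f (w : 𝓢'(ℝ, ℂ))

open Classical in
/-- The norm `‖m(D) f‖` in `L²`, when `m(D) f ∈ L²`
(the value does not depend on the choice, see `multiplierNorm_eq`). -/
def multiplierNorm (m : ℝ → ℝ) (f : 𝓢'(ℝ, ℂ)) : ℝ :=
  if h : MultiplierMemL2 m f then ‖h.choose‖ else 0

/-- The symbol `|ξ|^{-α}` of `Λ^{-α}`. -/
def lambdaSymbol (α : ℝ) : ℝ → ℝ := fun ξ => |ξ| ^ (-α)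

/-- The symbol `k = √l` of `K = L^{1/2}`. -/
def kSymbol (l : ℝ → ℝ) : ℝ → ℝ := fun ξ => √(l ξ)

/-- The symbol `l` is elliptic and coercive of order `ρ`. -/
def IsEllipticCoercive (l : ℝ → ℝ) (ρ : ℝ) : Prop :=
  ∃ c₁ c₂ : ℝ, 0 < c₁ ∧ 0 < c₂ ∧ ∀ ξ : ℝ,
    c₁ ^ 2 * (1 + ξ ^ 2) ^ (ρ / 2) ≤ l ξ ∧ l ξ ≤ c₂ ^ 2 * (1 + ξ ^ 2) ^ (ρ / 2)

/-- `f ∈ C(I, H^s)`; the Bessel potential of order `s` is an isomorphism from `H^s` onto `L²`. -/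
def ContinuousOnSobolev (s : ℝ) (f : ℝ → 𝓢'(ℝ, ℂ)) (I : Set ℝ) : Prop :=
  ∃ F : ℝ → L2C, ContinuousOn F I ∧
    ∀ t ∈ I, besselPotential ℝ ℂ s (f t) = (F t : 𝓢'(ℝ, ℂ))

/-- `f ∈ C¹(I, H^r)` with derivative `f'`. -/
def HasContDerivOnSobolev (r : ℝ) (f f' : ℝ → 𝓢'(ℝ, ℂ)) (I : Set ℝ) : Prop :=
  ∃ F F' : ℝ → L2C, ContinuousOn F' I ∧ ∀ t ∈ I, HasDerivWithinAt F (F' t) I t ∧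
    besselPotential ℝ ℂ r (f t) = (F t : 𝓢'(ℝ, ℂ)) ∧
    besselPotential ℝ ℂ r (f' t) = (F' t : 𝓢'(ℝ, ℂ))

/-- `u` is a real-valued solution on `[0, T)`, with time derivative `ut`, of the Cauchy problem
`u_tt - L u_xx = (g(u))_xx`, `u(0) = φ`, `u_t(0) = ψ`, in the class
`C([0, T), H^s) ∩ C¹([0, T), H^{s - 1 - ρ/2})`. The equation holds in the sense of distributions
in `x`. -/
structure IsSolution (l : ℝ → ℝ) (ρ s : ℝ) (g : ℝ → ℝ) (φ : L2R) (ψ : 𝓢'(ℝ, ℂ)) (T : ℝ)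
    (u : ℝ → L2R) (ut : ℝ → 𝓢'(ℝ, ℂ)) : Prop where
  cont : ContinuousOnSobolev s (fun t => toDist (u t)) (Ico 0 T)
  deriv : HasContDerivOnSobolev (s - 1 - ρ / 2) (fun t => toDist (u t)) ut (Ico 0 T)
  equation : ∀ t ∈ Ioo 0 T, ∃ Lu_xx gu : 𝓢'(ℝ, ℂ),
    IsMultiplier l (derivCLM ℂ (derivCLM ℂ (toDist (u t)))) Lu_xx ∧
    IsFunction gu (fun x => ((g (u t x) : ℝ) : ℂ)) ∧
    ∀ θ : 𝓢(ℝ, ℂ),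
      HasDerivAt (fun τ => ut τ θ) ((Lu_xx + derivCLM ℂ (derivCLM ℂ gu)) θ) t
  init : u 0 = φ
  init_deriv : ut 0 = ψ

/-- `G(p) = ∫₀^p g(q) dq`. -/
def primitive (g : ℝ → ℝ) (p : ℝ) : ℝ := ∫ q in (0 : ℝ)..p, g q

/-- The energy `‖Λ^{-1} q‖² + ‖K v‖² + 2 ∫ G(v) dx` of a state `v` with velocity `q`. -/
def energy (l g : ℝ → ℝ) (v : L2R) (q : 𝓢'(ℝ, ℂ)) : ℝ :=
  multiplierNorm (lambdaSymbol 1) q ^ 2 + multiplierNorm (kSymbol l) (toDist v) ^ 2 +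
    2 * ∫ x, primitive g (v x)

theorem IsFunction.locallyIntegrable {f : 𝓢'(ℝ, ℂ)} {F : ℝ → ℂ} (h : IsFunction f F) :
    LocallyIntegrable F := by
  intro x
  let b : ContDiffBump x := ⟨1, 2, by norm_num, by norm_num⟩
  have hb₁ : HasCompactSupport (Complex.ofRealCLM ∘ b) := b.hasCompactSupport.comp_left rfl
  have hb₂ : ContDiff ℝ (⊤ : ℕ∞) (Complex.ofRealCLM ∘ b) :=
    Complex.ofRealCLM.contDiff.comp b.contDiff
  refine ⟨Metric.closedBall x 1, Metric.closedBall_mem_nhds x one_pos, ?_⟩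
  refine ((h (hb₁.toSchwartzMap hb₂)).1.integrableOn (s := Metric.closedBall x 1)).congr_fun
    (fun y hy => ?_) Metric.isClosed_closedBall.measurableSet
  have : b y = 1 := b.one_of_mem_closedBall hy
  simp [this]

/-- The function that represents a distribution is unique almost everywhere. -/
theorem IsFunction.ae_eq {f : 𝓢'(ℝ, ℂ)} {F₁ F₂ : ℝ → ℂ} (h₁ : IsFunction f F₁)
    (h₂ : IsFunction f F₂) : F₁ =ᵐ[volume] F₂ := by
  refine ae_eq_of_integral_contDiff_smul_eq h₁.locallyIntegrable h₂.locallyIntegrable ?_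
  intro b hb hc
  have hb₁ : HasCompactSupport (Complex.ofRealCLM ∘ b) := hc.comp_left rfl
  have hb₂ : ContDiff ℝ (⊤ : ℕ∞) (Complex.ofRealCLM ∘ b) := Complex.ofRealCLM.contDiff.comp hb
  have e := (h₁ (hb₁.toSchwartzMap hb₂)).2.symm.trans (h₂ (hb₁.toSchwartzMap hb₂)).2
  simpa using e

/-- The distribution `m(D) f` is determined by `m` and `f`. -/
theorem IsMultiplier.unique {m : ℝ → ℝ} {f h₁ h₂ : 𝓢'(ℝ, ℂ)} (H₁ : IsMultiplier m f h₁)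
    (H₂ : IsMultiplier m f h₂) : h₁ = h₂ := by
  obtain ⟨F₁, hF₁, hG₁⟩ := H₁
  obtain ⟨F₂, hF₂, hG₂⟩ := H₂
  have e := hF₁.ae_eq hF₂
  have e' : 𝓕 h₁ = 𝓕 h₂ := by
    ext θ
    rw [(hG₁ θ).2, (hG₂ θ).2]
    refine integral_congr_ae ?_
    filter_upwards [e] with x hx
    rw [hx]
  simpa using congrArg (fun h : 𝓢'(ℝ, ℂ) => 𝓕⁻ h) e'

theorem multiplierNorm_eq {m : ℝ → ℝ} {f : 𝓢'(ℝ, ℂ)} {w : L2C}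
    (h : IsMultiplier m f (w : 𝓢'(ℝ, ℂ))) : multiplierNorm m f = ‖w‖ := by
  have H : MultiplierMemL2 m f := ⟨w, h⟩
  have e := H.choose_spec.unique h
  have : H.choose = w := by
    have hk := Lp.ker_toTemperedDistributionCLM_eq_bot (F := ℂ) (μ := (volume : Measure ℝ)) (p := 2)
    exact LinearMap.ker_eq_bot.1 hk e
  rw [multiplierNorm, dif_pos H, this]

end NonlocalWave

end

/-!
# Conservation of energy for a nonlocal nonlinear wave equation

On the Fourier side the equation is a family of forced oscillators of frequency `ω = |ξ| k(ξ)`,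
where `k = √l`. For a weight `κ(ξ)`, the energy `‖κ û‖² + ‖κ û_t / ω‖²` changes only through the
nonlinearity (`hasDerivAt_truncEnergy`). The distributional equation gives this after truncation to
annuli `1/(n+1) ≤ |η| ≤ n+1` of frequencies, where all symbols are bounded and `û`, `û_t` are
differentiable curves in `L²` (`IsSolution.exists_isSpectralSolution`,
`hasDerivAt_of_forall_schwartz`); the estimates do not depend on `n`.

On a compact time interval `u` is bounded, because `s > 1/2`, so `g` may be taken globally Lipschitz
and `G` of quadratic growth. A Lipschitz nonlinearity does not increase the `L²` norm of a
difference `u(· - h) - u` by more than a constant factor. With `κ = |exp (-2πi h η) - 1|`, the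
modulus of the symbol of this difference, Grönwall's inequality shows that the differences of `u(t)`
remain `O(h)`: the forcing is `|ξ| κ 𝓕 (g(u)) / k`, and `|ξ| ≤ C k` since `ρ ≥ 2`. Hence `u`
and `g(u)` are bounded in `H¹` (`exists_norm_mulLp_shiftSymbol_le`). With `κ = k` the same identity then gives `K u ∈ L²` and
`Λ⁻¹ u_t ∈ L²`, with bounds (`exists_norm_trunc_le`).

For the energy itself, let `u_n` be the frequency truncation of `u`. The functional `v ↦ ∫ G(v)` is
differentiable on `L²`, and the energy of `u_n` has the derivative
`-2 ⟪û_t / |ξ|, |ξ| 𝓕 (g(u) - g(u_n))⟫` restricted to the annulus. It is bounded, and it tends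
to zero at each time because `|ξ| 𝓕 (g(u) - g(u_n))` tends to zero weakly (`tendsto_energyDefect`).
Integrating in time and letting `n → ∞` gives conservation.
-/

noncomputable section

namespace NonlocalWave

open Filter Topology
open scoped ENNReal NNReal InnerProductSpace

/-! ### Multiplication operators on `L²` and their truncations to annuli -/

/-- Multiplication by a real function `m` as a bounded operator on `L²`;
the zero operator if `m` is not essentially bounded. -/
def mulLp (m : ℝ → ℝ) : L2C →L[ℝ] L2C :=
  open Classical in
  if h : MemLp m ∞ (volume : Measure ℝ) then
    (ContinuousLinearMap.lsmul ℝ ℝ : ℝ →L[ℝ] ℂ →L[ℝ] ℂ).holderL volume ∞ 2 2 (h.toLp m)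
  else 0

theorem coeFn_mulLp {m : ℝ → ℝ} (hm : MemLp m ∞ (volume : Measure ℝ)) (f : L2C) :
    mulLp m f =ᵐ[volume] fun x => m x • f x := by
  rw [mulLp, dif_pos hm]
  have h := (ContinuousLinearMap.lsmul ℝ ℝ : ℝ →L[ℝ] ℂ →L[ℝ] ℂ).coeFn_holder
    (r := 2) (hm.toLp m) f
  filter_upwards [h, hm.coeFn_toLp] with x hx hx'
  rw [← hx']
  exact hx

theorem mulLp_mulLp {a b : ℝ → ℝ} (ha : MemLp a ∞ (volume : Measure ℝ))
    (hb : MemLp b ∞ (volume : Measure ℝ)) (f : L2C) :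
    mulLp a (mulLp b f) = mulLp (fun x => a x * b x) f := by
  have hab : MemLp (fun x => a x * b x) ∞ (volume : Measure ℝ) := hb.mul' ha
  apply Lp.ext
  filter_upwards [coeFn_mulLp ha (mulLp b f), coeFn_mulLp hb f, coeFn_mulLp hab f]
    with x h1 h2 h3
  rw [h1, h2, h3, smul_smul]

theorem inner_eq_integral (f g : L2C) : ⟪f, g⟫_ℝ = ∫ x, ⟪f x, g x⟫_ℝ := rfl

theorem inner_mulLp_left {a : ℝ → ℝ} (ha : MemLp a ∞ (volume : Measure ℝ)) (f g : L2C) :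
    ⟪mulLp a f, g⟫_ℝ = ⟪f, mulLp a g⟫_ℝ := by
  rw [inner_eq_integral, inner_eq_integral]
  refine integral_congr_ae ?_
  filter_upwards [coeFn_mulLp ha f, coeFn_mulLp ha g] with x h1 h2
  rw [h1, h2, real_inner_smul_left, real_inner_smul_right]

/-- The annulus `1 / (n + 1) ≤ |η| ≤ n + 1` of frequencies. -/
def annulus (n : ℕ) : Set ℝ := {η | ((n : ℝ) + 1)⁻¹ ≤ |η| ∧ |η| ≤ n + 1}

theorem measurableSet_annulus (n : ℕ) : MeasurableSet (annulus n) :=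
  (measurableSet_le measurable_const measurable_norm).inter
    (measurableSet_le measurable_norm measurable_const)

theorem annulus_mono {m n : ℕ} (h : m ≤ n) : annulus m ⊆ annulus n := by
  intro η hη
  have : (m : ℝ) ≤ n := by exact_mod_cast h
  refine ⟨le_trans ?_ hη.1, hη.2.trans (by linarith)⟩
  gcongr

theorem ne_zero_of_mem_annulus {n : ℕ} {η : ℝ} (h : η ∈ annulus n) : η ≠ 0 := by
  rintro rfl
  have h1 := h.1
  rw [abs_zero] at h1
  have : (0 : ℝ) < ((n : ℝ) + 1)⁻¹ := by positivity
  linarith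

theorem eventually_mem_annulus {η : ℝ} (h : η ≠ 0) : ∀ᶠ n : ℕ in atTop, η ∈ annulus n := by
  obtain ⟨n, hn⟩ := exists_nat_ge (max |η| |η|⁻¹)
  filter_upwards [eventually_ge_atTop n] with m hm
  have hmn : (n : ℝ) ≤ m := by exact_mod_cast hm
  refine ⟨?_, ((le_max_left _ _).trans hn).trans (by linarith)⟩
  have := (le_max_right |η| |η|⁻¹).trans hn
  exact inv_le_of_inv_le₀ (abs_pos.2 h) (by linarith)

/-- A symbol that is measurable and bounded on every annulus. -/
structure IsAnnularSymbol (κ : ℝ → ℝ) : Prop where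
  measurable : Measurable κ
  bounded : ∀ n, ∃ C, ∀ η ∈ annulus n, |κ η| ≤ C

theorem IsAnnularSymbol.memLp {κ : ℝ → ℝ} (h : IsAnnularSymbol κ) (n : ℕ) :
    MemLp ((annulus n).indicator κ) ∞ (volume : Measure ℝ) := by
  obtain ⟨C, hC⟩ := h.bounded n
  refine memLp_top_of_bound
    (h.measurable.indicator (measurableSet_annulus n)).aestronglyMeasurable (max C 0)
    (Eventually.of_forall fun x => ?_)
  by_cases hx : x ∈ annulus n
  · rw [indicator_of_mem hx]
    exact (hC x hx).trans (le_max_left _ _)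
  · rw [indicator_of_notMem hx, norm_zero]
    exact le_max_right _ _

theorem IsAnnularSymbol.mul {a b : ℝ → ℝ} (ha : IsAnnularSymbol a) (hb : IsAnnularSymbol b) :
    IsAnnularSymbol (fun η => a η * b η) := by
  refine ⟨ha.measurable.mul hb.measurable, fun n => ?_⟩
  obtain ⟨A, hA⟩ := ha.bounded n
  obtain ⟨B, hB⟩ := hb.bounded n
  refine ⟨A * B, fun η hη => ?_⟩
  rw [abs_mul]
  exact mul_le_mul (hA η hη) (hB η hη) (abs_nonneg _) ((abs_nonneg _).trans (hA η hη))

theorem IsAnnularSymbol.of_abs_le {a b : ℝ → ℝ} (ha : Measurable a) (hb : IsAnnularSymbol b)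
    (h : ∀ η, η ≠ 0 → |a η| ≤ |b η|) : IsAnnularSymbol a := by
  refine ⟨ha, fun n => ?_⟩
  obtain ⟨B, hB⟩ := hb.bounded n
  exact ⟨B, fun η hη => (h η (ne_zero_of_mem_annulus hη)).trans (hB η hη)⟩

theorem isCompact_annulus (n : ℕ) : IsCompact (annulus n) := by
  refine Metric.isCompact_of_isClosed_isBounded ?_ ?_
  · exact (isClosed_le continuous_const continuous_abs).inter
      (isClosed_le continuous_abs continuous_const)
  · refine (Metric.isBounded_closedBall (x := (0 : ℝ)) (r := n + 1)).subset fun η hη => ?_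
    simpa using hη.2

theorem isAnnularSymbol_of_continuousOn {κ : ℝ → ℝ} (hm : Measurable κ)
    (h : ContinuousOn κ {0}ᶜ) : IsAnnularSymbol κ := by
  refine ⟨hm, fun n => ?_⟩
  exact (isCompact_annulus n).exists_bound_of_continuousOn
    (h.mono fun η hη => ne_zero_of_mem_annulus hη)

theorem isAnnularSymbol_const (c : ℝ) : IsAnnularSymbol (fun _ => c) :=
  isAnnularSymbol_of_continuousOn measurable_const continuousOn_const

/-- Multiplication by the restriction of the symbol `κ` to the annulus `annulus n`. -/
def trunc (n : ℕ) (κ : ℝ → ℝ) : L2C →L[ℝ] L2C := mulLp ((annulus n).indicator κ)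

theorem coeFn_trunc {κ : ℝ → ℝ} (h : IsAnnularSymbol κ) (n : ℕ) (f : L2C) :
    trunc n κ f =ᵐ[volume] fun η => (annulus n).indicator κ η • f η :=
  coeFn_mulLp (h.memLp n) f

theorem trunc_congr {a b : ℝ → ℝ} (n : ℕ) (h : ∀ η, η ≠ 0 → a η = b η) :
    trunc n a = trunc n b := by
  rw [trunc, trunc]
  congr 1
  exact indicator_congr fun η hη => h η (ne_zero_of_mem_annulus hη)

theorem inner_trunc_left {a : ℝ → ℝ} (ha : IsAnnularSymbol a) (n : ℕ) (f g : L2C) :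
    ⟪trunc n a f, g⟫_ℝ = ⟪f, trunc n a g⟫_ℝ :=
  inner_mulLp_left (ha.memLp n) f g

/-- If `F = κ f` almost everywhere, a truncation of `F` is a truncation of `f`. -/
theorem trunc_of_ae_eq {a κ : ℝ → ℝ} {f F : L2C} (ha : IsAnnularSymbol a)
    (hκ : IsAnnularSymbol κ) (h : F =ᵐ[volume] fun η => κ η • f η) (n : ℕ) :
    trunc n a F = trunc n (fun η => a η * κ η) f := by
  apply Lp.ext
  filter_upwards [coeFn_trunc ha n F, coeFn_trunc (ha.mul hκ) n f, h] with η h1 h2 h3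
  rw [h1, h2, h3]
  by_cases hη : η ∈ annulus n
  · rw [indicator_of_mem hη, indicator_of_mem hη, smul_smul]
  · simp only [indicator_of_notMem hη, zero_smul]

theorem trunc_trunc_min {a b : ℝ → ℝ} (ha : IsAnnularSymbol a) (hb : IsAnnularSymbol b)
    (m n : ℕ) (f : L2C) :
    trunc m a (trunc n b f) = trunc (min m n) (fun η => a η * b η) f := by
  apply Lp.ext
  filter_upwards [coeFn_trunc ha m (trunc n b f), coeFn_trunc hb n f,
    coeFn_trunc (ha.mul hb) (min m n) f] with η h1 h2 h3
  rw [h1, h2, h3, smul_smul]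
  congr 1
  rcases le_total m n with h | h
  · rw [min_eq_left h]
    by_cases hη : η ∈ annulus m
    · rw [indicator_of_mem hη, indicator_of_mem hη, indicator_of_mem (annulus_mono h hη)]
    · rw [indicator_of_notMem hη, indicator_of_notMem hη, zero_mul]
  · rw [min_eq_right h]
    by_cases hη : η ∈ annulus n
    · rw [indicator_of_mem hη, indicator_of_mem hη, indicator_of_mem (annulus_mono h hη)]
    · rw [indicator_of_notMem hη, indicator_of_notMem hη, mul_zero]

theorem trunc_trunc {a b : ℝ → ℝ} (ha : IsAnnularSymbol a) (hb : IsAnnularSymbol b)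
    (n : ℕ) (f : L2C) : trunc n a (trunc n b f) = trunc n (fun η => a η * b η) f := by
  rw [trunc_trunc_min ha hb, min_self]

theorem norm_trunc_le_of_ae {a : ℝ → ℝ} (ha : IsAnnularSymbol a) {f F : L2C} {C : ℝ}
    (hC : 0 ≤ C) (h : ∀ᵐ η, |a η| * ‖f η‖ ≤ C * ‖F η‖) (n : ℕ) :
    ‖trunc n a f‖ ≤ C * ‖F‖ := by
  refine Lp.norm_le_mul_norm_of_ae_le_mul ?_
  filter_upwards [coeFn_trunc ha n f, h] with η h1 h2
  rw [h1]
  by_cases hη : η ∈ annulus n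
  · rw [indicator_of_mem hη, norm_smul]
    exact h2
  · rw [indicator_of_notMem hη, zero_smul, norm_zero]
    positivity

theorem norm_trunc_one_le (n : ℕ) (f : L2C) : ‖trunc n (fun _ => 1) f‖ ≤ ‖f‖ := by
  simpa using norm_trunc_le_of_ae (isAnnularSymbol_const 1) (f := f) (F := f) zero_le_one
    (Eventually.of_forall fun η => by simp) n

theorem ae_ne_zero : ∀ᵐ η : ℝ, η ≠ 0 := by
  simp [ae_iff]

theorem tendsto_trunc_one (f : L2C) :
    Tendsto (fun n => trunc n (fun _ => 1) f) atTop (𝓝 f) := by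
  rw [tendsto_iff_norm_sub_tendsto_zero]
  have key : ∀ n, ‖trunc n (fun _ => 1) f - f‖ ^ 2
      = ∫ η, (annulus n)ᶜ.indicator (fun η => ‖f η‖ ^ 2) η := by
    intro n
    rw [← real_inner_self_eq_norm_sq, inner_eq_integral]
    refine integral_congr_ae ?_
    filter_upwards [coeFn_trunc (isAnnularSymbol_const 1) n f,
      Lp.coeFn_sub (trunc n (fun _ => 1) f) f] with η h1 h2
    rw [h2, Pi.sub_apply, h1, real_inner_self_eq_norm_sq]
    by_cases hη : η ∈ annulus n
    · simp [hη]
    · simp [hη]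
  have hi : Integrable (fun η => ‖f η‖ ^ 2) := (Lp.memLp f).integrable_norm_pow (by norm_num)
  have h0 : Tendsto (fun n => ‖trunc n (fun _ => 1) f - f‖ ^ 2) atTop (𝓝 0) := by
    simp_rw [key]
    rw [← integral_zero ℝ ℝ]
    refine tendsto_integral_of_dominated_convergence (fun η => ‖f η‖ ^ 2)
      (fun n => hi.aestronglyMeasurable.indicator (measurableSet_annulus n).compl) hi
      (fun n => Eventually.of_forall fun η => ?_) ?_
    · refine (norm_indicator_le_norm_self _ _).trans ?_
      simp
    · filter_upwards [ae_ne_zero] with η hη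
      refine tendsto_const_nhds.congr' ?_
      filter_upwards [eventually_mem_annulus hη] with n hn
      simp [hn]
  have := h0.sqrt
  simpa [Real.sqrt_sq (norm_nonneg _)] using this

/-- If the truncations of `κ f` are bounded in `L²`, then `κ f ∈ L²`. -/
theorem exists_ae_eq_of_norm_trunc_le {κ : ℝ → ℝ} (h : IsAnnularSymbol κ) {f : L2C} {K : ℝ}
    (hK : ∀ n, ‖trunc n κ f‖ ≤ K) :
    ∃ F : L2C, (F =ᵐ[volume] fun η => κ η • f η) ∧ ‖F‖ ≤ K := by
  have hmeas : AEStronglyMeasurable (fun η => κ η • f η) volume :=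
    h.measurable.aestronglyMeasurable.smul (Lp.aestronglyMeasurable f)
  have hlim : ∀ᵐ η, Tendsto (fun n => trunc n κ f η) atTop (𝓝 (κ η • f η)) := by
    have := ae_all_iff.2 fun n => coeFn_trunc h n f
    filter_upwards [this, ae_ne_zero] with η h1 h2
    refine tendsto_const_nhds.congr' ?_
    filter_upwards [eventually_mem_annulus h2] with n hn
    rw [h1, indicator_of_mem hn]
  have hle : eLpNorm (fun η => κ η • f η) 2 volume ≤ ENNReal.ofReal K := by
    refine (Lp.eLpNorm_lim_le_liminf_eLpNorm (fun n => Lp.aestronglyMeasurable (trunc n κ f)) _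
      hlim).trans ?_
    refine liminf_le_of_le (by isBoundedDefault) fun b hb => ?_
    obtain ⟨n, hn⟩ := hb.exists
    refine hn.trans ?_
    rw [← ENNReal.ofReal_toReal (Lp.eLpNorm_ne_top (trunc n κ f)), ← Lp.norm_def]
    exact ENNReal.ofReal_le_ofReal (hK n)
  have hmem : MemLp (fun η => κ η • f η) 2 volume := ⟨hmeas, hle.trans_lt ENNReal.ofReal_lt_top⟩
  refine ⟨hmem.toLp _, hmem.coeFn_toLp, ?_⟩
  rw [Lp.norm_toLp]
  exact ENNReal.toReal_le_of_le_ofReal ((norm_nonneg _).trans (hK 0)) hle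

/-! ### Real parts and the Fourier transform on `L²` as a real Hilbert space -/

/-- The real part of an `L²` function. -/
def reL2 : L2C →L[ℝ] L2R := Complex.reCLM.compLpL 2 volume

/-- The inclusion of the real-valued into the complex-valued `L²` functions. -/
def ofRealL2 : L2R →L[ℝ] L2C := Complex.ofRealCLM.compLpL 2 volume

theorem coeFn_reL2 (f : L2C) : reL2 f =ᵐ[volume] fun x => (f x).re :=
  Complex.reCLM.coeFn_compLpL f

theorem coeFn_ofRealL2 (v : L2R) : ofRealL2 v =ᵐ[volume] fun x => (v x : ℂ) :=
  Complex.ofRealCLM.coeFn_compLpL v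

theorem reL2_ofRealL2 (v : L2R) : reL2 (ofRealL2 v) = v := by
  apply Lp.ext
  filter_upwards [coeFn_reL2 (ofRealL2 v), coeFn_ofRealL2 v] with x h1 h2
  rw [h1, h2, Complex.ofReal_re]

theorem norm_ofRealL2 (v : L2R) : ‖ofRealL2 v‖ = ‖v‖ := by
  refine le_antisymm (Lp.norm_le_norm_of_ae_le ?_) (Lp.norm_le_norm_of_ae_le ?_) <;>
  · filter_upwards [coeFn_ofRealL2 v] with x h
    rw [h, Complex.norm_real]

theorem norm_reL2_le (f : L2C) : ‖reL2 f‖ ≤ ‖f‖ := by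
  refine Lp.norm_le_norm_of_ae_le ?_
  filter_upwards [coeFn_reL2 f] with x h
  rw [h]
  exact Complex.abs_re_le_norm _

theorem inner_reL2_right (v : L2R) (f : L2C) : ⟪v, reL2 f⟫_ℝ = ⟪ofRealL2 v, f⟫_ℝ := by
  rw [inner_eq_integral, L2.inner_def]
  refine integral_congr_ae ?_
  filter_upwards [coeFn_reL2 f, coeFn_ofRealL2 v] with x h1 h2
  rw [h1, h2]
  simp [Complex.inner, mul_comm]

/-- The Fourier transform as an isometry of the real Hilbert space underlying `L²`. -/
def fourierL2 : L2C ≃ₗᵢ[ℝ] L2C where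
  toLinearEquiv := (Lp.fourierTransformₗᵢ ℝ ℂ).toLinearEquiv.restrictScalars ℝ
  norm_map' f := (Lp.fourierTransformₗᵢ ℝ ℂ).norm_map f

theorem fourierL2_apply (f : L2C) : fourierL2 f = 𝓕 f := rfl

/-! ### Translations and their symbols -/

section Shift

variable {E : Type*} [NormedAddCommGroup E]

/-- Translation by `h` on `L²`. -/
def shift (h : ℝ) : Lp E 2 (volume : Measure ℝ) →+ Lp E 2 (volume : Measure ℝ) :=
  Lp.compMeasurePreserving (fun x => x - h) (measurePreserving_sub_right volume h)

theorem coeFn_shift (h : ℝ) (f : Lp E 2 (volume : Measure ℝ)) :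
    shift h f =ᵐ[volume] fun x => f (x - h) :=
  Lp.coeFn_compMeasurePreserving f _

theorem ae_shift {p : ℝ → Prop} (h : ℝ) (hp : ∀ᵐ x, p x) : ∀ᵐ x, p (x - h) :=
  (measurePreserving_sub_right volume h).quasiMeasurePreserving.ae hp

theorem continuous_shift (h : ℝ) :
    Continuous (shift h : Lp E 2 (volume : Measure ℝ) → Lp E 2 (volume : Measure ℝ)) :=
  (Lp.isometry_compMeasurePreserving _).continuous

end Shift

/-- The modulus `|exp (-2πi h η) - 1|` of the symbol of the difference operator
`f ↦ f (· - h) - f`. -/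
def shiftSymbol (h : ℝ) (η : ℝ) : ℝ := 2 * |Real.sin (Real.pi * h * η)|

theorem shiftSymbol_nonneg (h η : ℝ) : 0 ≤ shiftSymbol h η := by
  unfold shiftSymbol; positivity

theorem shiftSymbol_le_two (h η : ℝ) : shiftSymbol h η ≤ 2 := by
  have := Real.abs_sin_le_one (Real.pi * h * η)
  unfold shiftSymbol; linarith

theorem continuous_shiftSymbol (h : ℝ) : Continuous (shiftSymbol h) := by
  unfold shiftSymbol; fun_prop

theorem memLp_shiftSymbol (h : ℝ) : MemLp (shiftSymbol h) ∞ (volume : Measure ℝ) :=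
  memLp_top_of_bound (continuous_shiftSymbol h).aestronglyMeasurable 2
    (Eventually.of_forall fun η => by
      rw [Real.norm_of_nonneg (shiftSymbol_nonneg h η)]; exact shiftSymbol_le_two h η)

theorem isAnnularSymbol_shiftSymbol (h : ℝ) : IsAnnularSymbol (shiftSymbol h) :=
  isAnnularSymbol_of_continuousOn (continuous_shiftSymbol h).measurable
    (continuous_shiftSymbol h).continuousOn

/-- The modulus `|ξ|` of the symbol of `∂ₓ`, at the frequency `ξ = 2πη`. -/
def absSymbol (η : ℝ) : ℝ := |2 * Real.pi * η|

theorem absSymbol_nonneg (η : ℝ) : 0 ≤ absSymbol η := abs_nonneg _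

theorem absSymbol_pos {η : ℝ} (h : η ≠ 0) : 0 < absSymbol η :=
  abs_pos.2 (mul_ne_zero (mul_ne_zero two_ne_zero Real.pi_ne_zero) h)

theorem continuous_absSymbol : Continuous absSymbol := by
  unfold absSymbol; fun_prop

theorem isAnnularSymbol_absSymbol : IsAnnularSymbol absSymbol :=
  isAnnularSymbol_of_continuousOn continuous_absSymbol.measurable continuous_absSymbol.continuousOn

theorem shiftSymbol_le (h η : ℝ) : shiftSymbol h η ≤ |h| * absSymbol η := by
  have := Real.abs_sin_le_abs (x := Real.pi * h * η)
  unfold shiftSymbol absSymbol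
  rw [← abs_mul]
  calc 2 * |Real.sin (Real.pi * h * η)| ≤ |2| * |Real.pi * h * η| := by
        rw [abs_two]; linarith
    _ = _ := by rw [← abs_mul]; congr 1; ring

/-- On the annulus `annulus n` a shift by `h = 1 / (4 (n + 1))` keeps the argument `π h η` of the
sine in `shiftSymbol` below `π / 2`, where the sine is comparable to its argument. -/
theorem absSymbol_le_of_mem_annulus {n : ℕ} {η : ℝ} (h : η ∈ annulus n) :
    absSymbol η ≤ 8 * ((n : ℝ) + 1) * shiftSymbol (4 * ((n : ℝ) + 1))⁻¹ η := by
  have hn : (0 : ℝ) < n + 1 := by positivity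
  set x : ℝ := Real.pi * (4 * ((n : ℝ) + 1))⁻¹ * |η| with hx
  have hx0 : 0 ≤ x := by positivity
  have hx1 : x ≤ Real.pi / 2 := by
    have : x ≤ Real.pi * (4 * ((n : ℝ) + 1))⁻¹ * (n + 1) :=
      mul_le_mul_of_nonneg_left h.2 (by positivity)
    have e : Real.pi * (4 * ((n : ℝ) + 1))⁻¹ * (n + 1) = Real.pi / 4 := by field_simp
    linarith [Real.pi_pos]
  have hs := Real.mul_le_sin hx0 hx1
  have hs' : |Real.sin (Real.pi * (4 * ((n : ℝ) + 1))⁻¹ * η)| = Real.sin x := by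
    have : |Real.pi * (4 * ((n : ℝ) + 1))⁻¹ * η| = x := by
      rw [hx, abs_mul, abs_of_nonneg (a := Real.pi * _) (by positivity)]
    rw [Real.abs_sin_eq_sin_abs_of_abs_le_pi (by rw [this]; linarith [Real.pi_pos]), this]
  have e1 : absSymbol η = 8 * (n + 1) * x := by
    rw [absSymbol, abs_mul, abs_of_nonneg (by positivity : (0 : ℝ) ≤ 2 * Real.pi), hx]
    field_simp
    ring
  rw [shiftSymbol, hs', e1]
  have h2 : x ≤ 2 * Real.sin x := by
    have : 1 / 2 * x ≤ 2 / Real.pi * x := by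
      refine mul_le_mul_of_nonneg_right ?_ hx0
      rw [div_le_div_iff₀ two_pos Real.pi_pos]
      linarith [Real.pi_le_four]
    linarith
  calc 8 * ((n : ℝ) + 1) * x ≤ 8 * (n + 1) * (2 * Real.sin x) := by gcongr
    _ = _ := by ring

/-- Plancherel's identity for the difference operator `f ↦ f (· - h) - f`. -/
theorem norm_mulLp_shiftSymbol_fourier (h : ℝ) (f : L2C) :
    ‖mulLp (shiftSymbol h) (fourierL2 f)‖ = ‖shift h f - f‖ := by
  refine DenseRange.induction_on
    (p := fun f : L2C => ‖mulLp (shiftSymbol h) (fourierL2 f)‖ = ‖shift h f - f‖)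
    (SchwartzMap.denseRange_toLpCLM (p := 2) (μ := volume) ENNReal.ofNat_ne_top) f ?_ ?_
  · refine isClosed_eq ?_ ?_
    · exact ((mulLp _).continuous.comp fourierL2.continuous).norm
    · exact ((continuous_shift h).sub continuous_id).norm
  intro φ
  rw [fourierL2_apply, SchwartzMap.toLpCLM_apply]
  have e1 : shift h (φ.toLp 2) = (φ.compSubConstCLM ℂ h).toLp 2 := by
    apply Lp.ext
    filter_upwards [coeFn_shift h (φ.toLp 2), (φ.compSubConstCLM ℂ h).coeFn_toLp 2,
      ae_shift h (φ.coeFn_toLp 2 volume)] with x h1 h2 h3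
    rw [h1, h2, h3, SchwartzMap.compSubConstCLM_apply]
  rw [e1, ← fourierL2.norm_map (_ - _), map_sub, fourierL2_apply, fourierL2_apply,
    SchwartzMap.toLp_fourier_eq, SchwartzMap.toLp_fourier_eq]
  have e2 : ∀ η, 𝓕 (φ.compSubConstCLM ℂ h) η
      = Complex.exp (Complex.I * ((-(2 * Real.pi * h * η) : ℝ) : ℂ)) * 𝓕 φ η := by
    intro η
    rw [SchwartzMap.fourier_coe, SchwartzMap.fourier_coe, Real.fourier_eq', Real.fourier_eq',
      ← integral_const_mul]
    symm
    rw [← integral_sub_right_eq_self _ h]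
    refine integral_congr_ae (Eventually.of_forall fun x => ?_)
    simp only [SchwartzMap.compSubConstCLM_apply, smul_eq_mul]
    rw [← mul_assoc, ← Complex.exp_add]
    congr 2
    simp
    ring
  have e3 : ∀ᵐ η, ‖mulLp (shiftSymbol h) ((𝓕 φ).toLp 2) η‖
      = ‖((𝓕 (φ.compSubConstCLM ℂ h)).toLp 2 - (𝓕 φ).toLp 2 : L2C) η‖ := by
    filter_upwards [coeFn_mulLp (memLp_shiftSymbol h) ((𝓕 φ).toLp 2),
      Lp.coeFn_sub ((𝓕 (φ.compSubConstCLM ℂ h)).toLp 2 : L2C) ((𝓕 φ).toLp 2),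
      (𝓕 (φ.compSubConstCLM ℂ h)).coeFn_toLp 2, (𝓕 φ).coeFn_toLp 2] with η h1 h2 h3 h4
    rw [h1, h2, Pi.sub_apply, h3, h4, e2, norm_smul, ← sub_one_mul, norm_mul,
      Complex.norm_exp_I_mul_ofReal_sub_one]
    congr 1
    rw [Real.norm_of_nonneg (shiftSymbol_nonneg _ _), shiftSymbol, Real.norm_eq_abs, abs_mul,
      abs_two, ← abs_neg (Real.sin (_ / 2)), ← Real.sin_neg]
    congr 3
    ring
  exact le_antisymm (Lp.norm_le_norm_of_ae_le (e3.mono fun _ h => h.le))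
    (Lp.norm_le_norm_of_ae_le (e3.mono fun _ h => h.ge))

/-- If the differences `v (· - h) - v` are `O(h)` in `L²`, then `∂ₓ v` is in `L²`: the bound on the
truncations of `|ξ| f`, where `f` is the Fourier transform of `v`. -/
theorem norm_trunc_absSymbol_le {f : L2C} {K : ℝ}
    (hf : ∀ h : ℝ, ‖mulLp (shiftSymbol h) f‖ ≤ K * |h|) (n : ℕ) :
    ‖trunc n absSymbol f‖ ≤ 2 * K := by
  have hn : (0 : ℝ) < 4 * ((n : ℝ) + 1) := by positivity
  have h1 : ‖trunc n absSymbol f‖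
      ≤ 8 * ((n : ℝ) + 1) * ‖mulLp (shiftSymbol (4 * ((n : ℝ) + 1))⁻¹) f‖ := by
    refine Lp.norm_le_mul_norm_of_ae_le_mul ?_
    filter_upwards [coeFn_trunc isAnnularSymbol_absSymbol n f,
      coeFn_mulLp (memLp_shiftSymbol (4 * ((n : ℝ) + 1))⁻¹) f] with η h1 h2
    rw [h1, h2, norm_smul, norm_smul, ← mul_assoc, Real.norm_of_nonneg (shiftSymbol_nonneg _ _)]
    refine mul_le_mul_of_nonneg_right ?_ (norm_nonneg _)
    by_cases hη : η ∈ annulus n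
    · rw [indicator_of_mem hη, Real.norm_of_nonneg (absSymbol_nonneg _)]
      exact absSymbol_le_of_mem_annulus hη
    · rw [indicator_of_notMem hη, norm_zero]
      have := shiftSymbol_nonneg (4 * ((n : ℝ) + 1))⁻¹ η
      positivity
  refine h1.trans ?_
  have h2 := hf (4 * ((n : ℝ) + 1))⁻¹
  rw [abs_of_pos (by positivity)] at h2
  calc _ ≤ 8 * ((n : ℝ) + 1) * (K * (4 * ((n : ℝ) + 1))⁻¹) := by gcongr
    _ = 2 * K := by field_simp; ring

theorem norm_shift_reL2_sub_le (h : ℝ) (f : L2C) :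
    ‖shift h (reL2 f) - reL2 f‖ ≤ ‖shift h f - f‖ := by
  have e : shift h (reL2 f) = reL2 (shift h f) := by
    apply Lp.ext
    filter_upwards [coeFn_shift h (reL2 f), coeFn_reL2 (shift h f), coeFn_shift h f,
      ae_shift h (coeFn_reL2 f)] with x h1 h2 h3 h4
    rw [h1, h2, h3, h4]
  rw [e, ← map_sub]
  exact norm_reL2_le _

theorem shift_ofRealL2 (h : ℝ) (v : L2R) : shift h (ofRealL2 v) = ofRealL2 (shift h v) := by
  apply Lp.ext
  filter_upwards [coeFn_shift h (ofRealL2 v), coeFn_ofRealL2 (shift h v), coeFn_shift h v,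
    ae_shift h (coeFn_ofRealL2 v)] with x h1 h2 h3 h4
  rw [h1, h2, h3, h4]

/-! ### Lipschitz nonlinearities on `L²` -/

section Nonlinearity

variable {g : ℝ → ℝ} {c : ℝ≥0} (hg : LipschitzWith c g) (g0 : g 0 = 0)

theorem shift_compLp (h : ℝ) (v : L2R) : shift h (hg.compLp g0 v) = hg.compLp g0 (shift h v) := by
  apply Lp.ext
  filter_upwards [coeFn_shift h (hg.compLp g0 v), hg.coeFn_compLp g0 (shift h v), coeFn_shift h v,
    ae_shift h (hg.coeFn_compLp g0 v)] with x h1 h2 h3 h4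
  rw [h1, h2, h4, Function.comp_apply, Function.comp_apply, h3]

/-- The Fourier transform of `g ∘ v`. -/
def fourierComp (v : L2R) : L2C := fourierL2 (ofRealL2 (hg.compLp g0 v))

theorem continuous_fourierComp : Continuous (fourierComp hg g0) :=
  fourierL2.continuous.comp (ofRealL2.continuous.comp (hg.continuous_compLp g0))

/-- A Lipschitz nonlinearity increases differences `v (· - h) - v` by a factor at most. This
replaces the chain rule `∂ₓ g(v) = g'(v) ∂ₓ v`. -/
theorem norm_mulLp_shiftSymbol_fourierComp_le (h : ℝ) (v : L2R) :
    ‖mulLp (shiftSymbol h) (fourierComp hg g0 v)‖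
      ≤ c * ‖mulLp (shiftSymbol h) (fourierL2 (ofRealL2 v))‖ := by
  rw [fourierComp, norm_mulLp_shiftSymbol_fourier, norm_mulLp_shiftSymbol_fourier,
    shift_ofRealL2, shift_ofRealL2, ← map_sub, ← map_sub, norm_ofRealL2, norm_ofRealL2,
    shift_compLp]
  exact hg.norm_compLp_sub_le g0 _ _

/-- The bound on `∂ₓ g(v)` for `v = Re 𝓕⁻¹ f`. -/
theorem norm_trunc_absSymbol_fourierComp_le {f : L2C} {K : ℝ}
    (hf : ∀ h : ℝ, ‖mulLp (shiftSymbol h) f‖ ≤ K * |h|) (n : ℕ) :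
    ‖trunc n absSymbol (fourierComp hg g0 (reL2 (fourierL2.symm f)))‖ ≤ 2 * (c * K) := by
  refine norm_trunc_absSymbol_le (fun h => ?_) n
  refine (norm_mulLp_shiftSymbol_fourierComp_le hg g0 h _).trans ?_
  rw [mul_assoc]
  refine mul_le_mul_of_nonneg_left ?_ c.coe_nonneg
  rw [norm_mulLp_shiftSymbol_fourier, shift_ofRealL2, ← map_sub, norm_ofRealL2]
  refine (norm_shift_reL2_sub_le h _).trans ?_
  rw [← norm_mulLp_shiftSymbol_fourier, LinearIsometryEquiv.apply_symm_apply]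
  exact hf h

end Nonlinearity

/-! ### The potential energy on `L²` -/

section Potential

variable {g : ℝ → ℝ} {c : ℝ≥0}

theorem abs_primitive_sub_sub_le (hg : LipschitzWith c g) (a b : ℝ) :
    |primitive g b - primitive g a - g a * (b - a)| ≤ c * (b - a) ^ 2 := by
  have hi : ∀ a b, IntervalIntegrable g volume a b := fun a b =>
    hg.continuous.intervalIntegrable a b
  have e : primitive g b - primitive g a - g a * (b - a) = ∫ q in a..b, (g q - g a) := by
    rw [intervalIntegral.integral_sub (hi a b) intervalIntegrable_const,
      intervalIntegral.integral_const, primitive, primitive,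
      intervalIntegral.integral_interval_sub_left (hi 0 b) (hi 0 a), smul_eq_mul, mul_comm (g a)]
  rw [e, ← Real.norm_eq_abs]
  refine (intervalIntegral.norm_integral_le_of_norm_le_const (C := c * |b - a|)
    fun q hq => ?_).trans (le_of_eq ?_)
  · refine (hg.dist_le_mul q a).trans ?_
    refine mul_le_mul_of_nonneg_left ?_ c.coe_nonneg
    rw [Real.dist_eq]
    exact abs_sub_left_of_mem_uIcc (uIoc_subset_uIcc hq)
  · rw [mul_assoc, abs_mul_abs_self, sq]

theorem continuous_primitive (hg : LipschitzWith c g) : Continuous (primitive g) :=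
  intervalIntegral.continuous_primitive (fun a b => hg.continuous.intervalIntegrable a b) 0

theorem abs_primitive_le (hg : LipschitzWith c g) (g0 : g 0 = 0) (p : ℝ) :
    |primitive g p| ≤ c * p ^ 2 := by
  have := abs_primitive_sub_sub_le hg 0 p
  simpa [g0, primitive] using this

theorem integrable_primitive (hg : LipschitzWith c g) (g0 : g 0 = 0) (v : L2R) :
    Integrable (fun x => primitive g (v x)) := by
  have h : Integrable (fun x => (c : ℝ) * ‖v x‖ ^ 2) :=
    ((Lp.memLp v).integrable_norm_pow (by norm_num)).const_mul _
  refine h.mono' ((continuous_primitive hg).comp_aestronglyMeasurable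
    (Lp.aestronglyMeasurable v)) (Eventually.of_forall fun x => ?_)
  rw [Real.norm_eq_abs, Real.norm_eq_abs, sq_abs]
  exact abs_primitive_le hg g0 _

/-- The functional `v ↦ ∫ G(v) dx` is differentiable on `L²`, with gradient `g ∘ v`. -/
theorem hasFDerivAt_integral_primitive (hg : LipschitzWith c g) (g0 : g 0 = 0) (v : L2R) :
    HasFDerivAt (fun w : L2R => ∫ x, primitive g (w x)) (innerSL ℝ (hg.compLp g0 v)) v := by
  refine HasFDerivAt.of_isLittleO ?_
  refine Asymptotics.IsBigO.trans_isLittleO (g := fun w => ‖w - v‖ ^ 2) ?_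
    (Asymptotics.isLittleO_pow_sub_sub v one_lt_two)
  refine Asymptotics.IsBigO.of_bound c (Eventually.of_forall fun w => ?_)
  have hsq : ∀ z : L2R, Integrable (fun x => (z x) ^ 2) := fun z => (Lp.memLp z).integrable_sq
  have hin : Integrable (fun x => ⟪(hg.compLp g0 v) x, (w - v) x⟫_ℝ) :=
    L2.integrable_inner (𝕜 := ℝ) (hg.compLp g0 v) (w - v)
  rw [innerSL_apply_apply, L2.inner_def, ← integral_sub (integrable_primitive hg g0 w)
    (integrable_primitive hg g0 v),
    ← integral_sub (f := fun x => primitive g (w x) - primitive g (v x))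
    ((integrable_primitive hg g0 w).sub (integrable_primitive hg g0 v)) hin]
  have hn : ‖w - v‖ ^ 2 = ∫ x, ((w - v) x) ^ 2 := by
    rw [← real_inner_self_eq_norm_sq, L2.inner_def]
    simp [sq]
  rw [Real.norm_of_nonneg (by positivity : (0 : ℝ) ≤ ‖w - v‖ ^ 2), hn, ← integral_const_mul]
  refine norm_integral_le_of_norm_le ((hsq _).const_mul _) ?_
  filter_upwards [hg.coeFn_compLp g0 v, Lp.coeFn_sub w v] with x h1 h2
  rw [h1, h2, Function.comp_apply, Pi.sub_apply, Real.norm_eq_abs]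
  have := abs_primitive_sub_sub_le hg (v x) (w x)
  simpa [mul_comm] using this

theorem continuous_integral_primitive (hg : LipschitzWith c g) (g0 : g 0 = 0) :
    Continuous (fun w : L2R => ∫ x, primitive g (w x)) :=
  continuous_iff_continuousAt.2 fun v => (hasFDerivAt_integral_primitive hg g0 v).continuousAt

end Potential

/-! ### Grönwall inequalities -/

/-- Grönwall's inequality for `y' ≤ y + b` with a nonnegative source `b`. -/
theorem le_exp_mul_add_integral {y y' b : ℝ → ℝ} {r : ℝ} (hy : ContinuousOn y (Icc 0 r))
    (hb : ContinuousOn b (Icc 0 r)) (hb0 : ∀ t ∈ Icc 0 r, 0 ≤ b t)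
    (hd : ∀ t ∈ Ioo 0 r, HasDerivAt y (y' t) t) (hle : ∀ t ∈ Ioo 0 r, y' t ≤ y t + b t) :
    ∀ t ∈ Icc 0 r, y t ≤ Real.exp t * (y 0 + ∫ τ in (0 : ℝ)..t, b τ) := by
  intro t ht
  have h0 : (0 : ℝ) ≤ r := ht.1.trans ht.2
  have hint : ∀ τ ∈ Icc 0 r, IntervalIntegrable b volume 0 τ := fun τ hτ =>
    (hb.mono (Icc_subset_Icc_right hτ.2)).intervalIntegrable_of_Icc hτ.1
  have hIc : ContinuousOn (fun τ => ∫ σ in (0 : ℝ)..τ, b σ) (Icc 0 r) := by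
    have := intervalIntegral.continuousOn_primitive_interval (μ := volume) (f := b) (a := 0)
      (b := r) (by rw [uIcc_of_le h0]; exact hb.integrableOn_Icc)
    rwa [uIcc_of_le h0] at this
  have hId : ∀ τ ∈ Ioo 0 r, HasDerivAt (fun τ => ∫ σ in (0 : ℝ)..τ, b σ) (b τ) τ := fun τ hτ =>
    intervalIntegral.integral_hasDerivAt_right (hint τ (Ioo_subset_Icc_self hτ))
      ((hb.mono Ioo_subset_Icc_self).stronglyMeasurableAtFilter isOpen_Ioo τ hτ)
      ((hb τ (Ioo_subset_Icc_self hτ)).continuousAt (Icc_mem_nhds hτ.1 hτ.2))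
  have hanti : AntitoneOn (fun τ => Real.exp (-τ) * y τ - ∫ σ in (0 : ℝ)..τ, b σ) (Icc 0 r) := by
    refine antitoneOn_of_hasDerivWithinAt_nonpos (convex_Icc 0 r)
      (f' := fun τ => (Real.exp (-τ) * (-1) * y τ + Real.exp (-τ) * y' τ) - b τ) ?_ ?_ ?_
    · exact ((Real.continuous_exp.comp continuous_neg).continuousOn.mul hy).sub hIc
    · intro τ hτ
      rw [interior_Icc] at hτ
      exact ((((hasDerivAt_neg τ).exp).mul (hd τ hτ)).sub (hId τ hτ)).hasDerivWithinAt
    · intro τ hτ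
      rw [interior_Icc] at hτ
      have h1 := hle τ hτ
      have h2 := hb0 τ (Ioo_subset_Icc_self hτ)
      have h3 : Real.exp (-τ) ≤ 1 := Real.exp_le_one_iff.2 (by linarith [hτ.1])
      have h4 := (Real.exp_pos (-τ)).le
      nlinarith [mul_le_mul_of_nonneg_left h1 h4, mul_le_mul_of_nonneg_right h3 h2]
  have h := hanti (left_mem_Icc.2 h0) ht ht.1
  simp only [neg_zero, Real.exp_zero, one_mul, intervalIntegral.integral_same, sub_zero] at h
  have h5 : Real.exp (-t) * y t ≤ y 0 + ∫ τ in (0 : ℝ)..t, b τ := by linarith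
  calc y t = Real.exp t * (Real.exp (-t) * y t) := by
        rw [← mul_assoc, ← Real.exp_add]; simp
    _ ≤ _ := mul_le_mul_of_nonneg_left h5 (Real.exp_pos t).le

/-- Grönwall's inequality in integral form. -/
theorem le_mul_exp_of_le_add_integral {N : ℝ → ℝ} {A B r : ℝ} (hB : 0 ≤ B)
    (hN : ContinuousOn N (Icc 0 r))
    (h : ∀ t ∈ Icc 0 r, N t ≤ A + B * ∫ τ in (0 : ℝ)..t, N τ) :
    ∀ t ∈ Icc 0 r, N t ≤ A * Real.exp (B * t) := by
  intro t ht
  have h0 : (0 : ℝ) ≤ r := ht.1.trans ht.2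
  have hint : ∀ τ ∈ Icc 0 r, IntervalIntegrable N volume 0 τ := fun τ hτ =>
    (hN.mono (Icc_subset_Icc_right hτ.2)).intervalIntegrable_of_Icc hτ.1
  have hIc : ContinuousOn (fun τ => ∫ σ in (0 : ℝ)..τ, N σ) (Icc 0 r) := by
    have := intervalIntegral.continuousOn_primitive_interval (μ := volume) (f := N) (a := 0)
      (b := r) (by rw [uIcc_of_le h0]; exact hN.integrableOn_Icc)
    rwa [uIcc_of_le h0] at this
  have hId : ∀ τ ∈ Ioo 0 r, HasDerivAt (fun τ => ∫ σ in (0 : ℝ)..τ, N σ) (N τ) τ := fun τ hτ =>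
    intervalIntegral.integral_hasDerivAt_right (hint τ (Ioo_subset_Icc_self hτ))
      ((hN.mono Ioo_subset_Icc_self).stronglyMeasurableAtFilter isOpen_Ioo τ hτ)
      ((hN τ (Ioo_subset_Icc_self hτ)).continuousAt (Icc_mem_nhds hτ.1 hτ.2))
  have hanti : AntitoneOn (fun τ => Real.exp (-(B * τ)) * (A + B * ∫ σ in (0 : ℝ)..τ, N σ))
      (Icc 0 r) := by
    refine antitoneOn_of_hasDerivWithinAt_nonpos (convex_Icc 0 r)
      (f' := fun τ => Real.exp (-(B * τ)) * (-(B * 1)) * (A + B * ∫ σ in (0 : ℝ)..τ, N σ)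
        + Real.exp (-(B * τ)) * (B * N τ)) ?_ ?_ ?_
    · refine ContinuousOn.mul (Continuous.continuousOn (by fun_prop)) ?_
      exact continuousOn_const.add (continuousOn_const.mul hIc)
    · intro τ hτ
      rw [interior_Icc] at hτ
      exact ((((hasDerivAt_id τ).const_mul B).neg.exp).mul
        (((hId τ hτ).const_mul B).const_add A)).hasDerivWithinAt
    · intro τ hτ
      rw [interior_Icc] at hτ
      have h1 := h τ (Ioo_subset_Icc_self hτ)
      have h4 := (Real.exp_pos (-(B * τ))).le
      nlinarith [mul_le_mul_of_nonneg_left h1 (mul_nonneg h4 hB)]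
  have h1 := hanti (left_mem_Icc.2 h0) ht ht.1
  simp only [mul_zero, neg_zero, Real.exp_zero, one_mul, intervalIntegral.integral_same,
    add_zero] at h1
  refine (h t ht).trans ?_
  calc A + B * ∫ τ in (0 : ℝ)..t, N τ
      = (Real.exp (-(B * t)) * (A + B * ∫ σ in (0 : ℝ)..t, N σ)) * Real.exp (B * t) := by
        rw [mul_right_comm, ← Real.exp_add]; simp
    _ ≤ _ := mul_le_mul_of_nonneg_right h1 (Real.exp_pos _).le

/-! ### The equation on the Fourier side -/

/-- The Fourier transform of a real-valued `L²` function. -/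
def fourierR (v : L2R) : L2C := fourierL2 (ofRealL2 v)

theorem continuous_fourierR : Continuous fourierR :=
  fourierL2.continuous.comp ofRealL2.continuous

theorem reL2_symm_fourierR (v : L2R) : reL2 (fourierL2.symm (fourierR v)) = v := by
  rw [fourierR, LinearIsometryEquiv.symm_apply_apply, reL2_ofRealL2]

theorem isAnnularSymbol_inv_absSymbol : IsAnnularSymbol (fun η => (absSymbol η)⁻¹) :=
  isAnnularSymbol_of_continuousOn continuous_absSymbol.measurable.inv
    (continuous_absSymbol.continuousOn.inv₀ fun _ hη => (absSymbol_pos hη).ne')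

theorem mulLp_trunc_one {m : ℝ → ℝ} (hm : MemLp m ∞ (volume : Measure ℝ)) (n : ℕ) (f : L2C) :
    mulLp m (trunc n (fun _ => 1) f) = trunc n (fun _ => 1) (mulLp m f) := by
  rw [trunc, mulLp_mulLp hm ((isAnnularSymbol_const 1).memLp n),
    mulLp_mulLp ((isAnnularSymbol_const 1).memLp n) hm]
  simp only [mul_comm]

theorem trunc_one_mulLp {m : ℝ → ℝ} (hm : MemLp m ∞ (volume : Measure ℝ))
    (hm' : IsAnnularSymbol m) (n : ℕ) (f : L2C) :
    trunc n (fun _ => 1) (mulLp m f) = trunc n m f := by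
  simpa using trunc_of_ae_eq (isAnnularSymbol_const 1) hm' (coeFn_mulLp hm f) n

theorem norm_trunc_mul_le {m b : ℝ → ℝ} (hm : MemLp m ∞ (volume : Measure ℝ))
    (hm' : IsAnnularSymbol m) (hb : IsAnnularSymbol b) {C : ℝ} (hC : 0 ≤ C)
    (h : ∀ η, η ≠ 0 → |b η| ≤ C) (n : ℕ) (f : L2C) :
    ‖trunc n (fun η => m η * b η) f‖ ≤ C * ‖mulLp m f‖ := by
  refine norm_trunc_le_of_ae (hm'.mul hb) hC ?_ n
  filter_upwards [coeFn_mulLp hm f, ae_ne_zero] with η h1 h2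
  rw [h1, norm_smul, abs_mul, Real.norm_eq_abs]
  calc |m η| * |b η| * ‖f η‖ ≤ |m η| * C * ‖f η‖ := by gcongr; exact h η h2
    _ = _ := by ring

/-- Symbols for which the energy method works: `k` is the symbol of `K`, which dominates that of
`∂ₓ`, and `w` is the weight with which the Fourier transform of `u_t` is represented by a curve in
`L²`. Both are functions of Mathlib's frequency `η = ξ / 2π`. -/
structure IsWaveSymbol (k w : ℝ → ℝ) (C : ℝ) : Prop where
  symbol_k : IsAnnularSymbol k
  symbol_w : IsAnnularSymbol w
  pos : ∀ η, 0 < k η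
  le : ∀ η, absSymbol η ≤ C * k η

/-- The equation `u_tt - L u_xx = (g(u))_xx` on `[0, r]` on the Fourier side, where `û_t = w Y`
with `Y` continuous in `L²`: it holds in `L²` after truncation to every annulus. -/
structure IsSpectralSolution (k w : ℝ → ℝ) {g : ℝ → ℝ} {c : ℝ≥0} (hg : LipschitzWith c g)
    (g0 : g 0 = 0) (u : ℝ → L2R) (Y : ℝ → L2C) (r : ℝ) : Prop where
  continuousOn_u : ContinuousOn u (Icc 0 r)
  continuousOn_Y : ContinuousOn Y (Icc 0 r)
  hasDerivAt_u : ∀ n κ, IsAnnularSymbol κ → ∀ t ∈ Ioo 0 r,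
    HasDerivAt (fun τ => trunc n κ (fourierR (u τ))) (trunc n (fun η => κ η * w η) (Y t)) t
  hasDerivAt_Y : ∀ n κ, IsAnnularSymbol κ → ∀ t ∈ Ioo 0 r,
    HasDerivAt (fun τ => trunc n (fun η => κ η * w η) (Y τ))
      (-trunc n (fun η => κ η * (absSymbol η * k η) ^ 2) (fourierR (u t))
        - trunc n (fun η => κ η * absSymbol η ^ 2) (fourierComp hg g0 (u t))) t

namespace IsWaveSymbol

variable {k w : ℝ → ℝ} {C : ℝ}

theorem nonneg (H : IsWaveSymbol k w C) : 0 ≤ C := by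
  have h1 := H.le 0
  have h2 := H.pos 0
  by_contra! hC
  have := absSymbol_nonneg 0
  nlinarith

theorem inv_k_le (H : IsWaveSymbol k w C) {η : ℝ} (hη : η ≠ 0) :
    (k η)⁻¹ ≤ C * (absSymbol η)⁻¹ := by
  have h1 := H.le η
  have h2 := H.pos η
  have h3 := absSymbol_pos hη
  rw [← div_eq_mul_inv, inv_eq_one_div, div_le_div_iff₀ h2 h3]
  linarith

theorem symbol_inv_k (H : IsWaveSymbol k w C) : IsAnnularSymbol (fun η => (k η)⁻¹) := by
  refine IsAnnularSymbol.of_abs_le H.symbol_k.measurable.inv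
    ((isAnnularSymbol_const C).mul isAnnularSymbol_inv_absSymbol) fun η hη => ?_
  rw [abs_of_pos (inv_pos.2 (H.pos η))]
  exact (H.inv_k_le hη).trans (le_abs_self _)

theorem symbol_freq (H : IsWaveSymbol k w C) : IsAnnularSymbol (fun η => absSymbol η * k η) :=
  isAnnularSymbol_absSymbol.mul H.symbol_k

theorem symbol_inv_freq (H : IsWaveSymbol k w C) :
    IsAnnularSymbol (fun η => (absSymbol η * k η)⁻¹) := by
  simp_rw [mul_inv]
  exact isAnnularSymbol_inv_absSymbol.mul H.symbol_inv_k

end IsWaveSymbol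

section Energy

variable {k w : ℝ → ℝ} {C : ℝ} {g : ℝ → ℝ} {c : ℝ≥0} {hg : LipschitzWith c g} {g0 : g 0 = 0}
  {u : ℝ → L2R} {Y : ℝ → L2C} {r : ℝ}

/-- The quadratic energy `‖κ û‖² + ‖κ û_t / (|ξ| k)‖²` with weight `κ`, truncated to an annulus. -/
def truncEnergy (k w κ : ℝ → ℝ) (n : ℕ) (v : L2R) (y : L2C) : ℝ :=
  ‖trunc n κ (fourierR v)‖ ^ 2 +
    ‖trunc n (fun η => κ η * (absSymbol η * k η)⁻¹ * w η) y‖ ^ 2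

theorem continuousOn_truncEnergy (S : IsSpectralSolution k w hg g0 u Y r) (κ : ℝ → ℝ) (n : ℕ) :
    ContinuousOn (fun t => truncEnergy k w κ n (u t) (Y t)) (Icc 0 r) := by
  refine ContinuousOn.add (ContinuousOn.pow ?_ 2) (ContinuousOn.pow ?_ 2)
  · exact ((trunc n κ).continuous.comp continuous_fourierR).norm.comp_continuousOn S.continuousOn_u
  · exact (trunc n _).continuous.norm.comp_continuousOn S.continuousOn_Y

/-- The quadratic energy changes only through the nonlinearity. -/
theorem hasDerivAt_truncEnergy (H : IsWaveSymbol k w C)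
    (S : IsSpectralSolution k w hg g0 u Y r) {κ : ℝ → ℝ} (hκ : IsAnnularSymbol κ) (n : ℕ)
    {t : ℝ} (ht : t ∈ Ioo 0 r) :
    HasDerivAt (fun t => truncEnergy k w κ n (u t) (Y t))
      (-2 * ⟪trunc n (fun η => κ η * (absSymbol η * k η)⁻¹ * w η) (Y t),
        trunc n (fun η => κ η * (absSymbol η * (k η)⁻¹)) (fourierComp hg g0 (u t))⟫_ℝ) t := by
  have hκ' := hκ.mul H.symbol_inv_freq
  have h1 := (S.hasDerivAt_u n κ hκ t ht).norm_sq
  have h2 := (S.hasDerivAt_Y n _ hκ' t ht).norm_sq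
  refine (h1.add h2).congr_deriv ?_
  have e1 : trunc n (fun η => κ η * w η) (Y t) = trunc n (fun η => absSymbol η * k η)
      (trunc n (fun η => κ η * (absSymbol η * k η)⁻¹ * w η) (Y t)) := by
    rw [trunc_trunc H.symbol_freq (hκ'.mul H.symbol_w)]
    refine congrArg (· (Y t)) (trunc_congr n fun η hη => ?_)
    have := (absSymbol_pos hη).ne'
    have := (H.pos η).ne'
    field_simp
  have e2 : trunc n (fun η => κ η * (absSymbol η * k η)⁻¹ * (absSymbol η * k η) ^ 2)
      (fourierR (u t)) = trunc n (fun η => absSymbol η * k η) (trunc n κ (fourierR (u t))) := by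
    rw [trunc_trunc H.symbol_freq hκ]
    refine congrArg (· (fourierR (u t))) (trunc_congr n fun η hη => ?_)
    have := (absSymbol_pos hη).ne'
    have := (H.pos η).ne'
    field_simp
  have e3 : trunc n (fun η => κ η * (absSymbol η * k η)⁻¹ * absSymbol η ^ 2)
      = trunc n (fun η => κ η * (absSymbol η * (k η)⁻¹)) := by
    refine trunc_congr n fun η hη => ?_
    have := (absSymbol_pos hη).ne'
    have := (H.pos η).ne'
    field_simp
  rw [e1, e2, e3, inner_sub_right, inner_neg_right,
    ← inner_trunc_left H.symbol_freq n (trunc n κ (fourierR (u t))),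
    real_inner_comm (trunc n (fun η => absSymbol η * k η) (trunc n κ (fourierR (u t))))]
  ring

theorem neg_two_mul_inner_le {F : Type*} [NormedAddCommGroup F] [InnerProductSpace ℝ F] (x y : F) :
    -2 * ⟪x, y⟫_ℝ ≤ ‖x‖ ^ 2 + ‖y‖ ^ 2 := by
  have h := norm_add_sq_real x y
  have := sq_nonneg ‖x + y‖
  linarith

/-- Propagation of `H¹` regularity: the differences of `u(t)` remain `O(h)`. The energy method with
the weight `shiftSymbol h` works without an a priori bound on `∂ₓ g(u)`, because this weight is a
bounded function; dividing by `h` afterwards loses nothing, as all constants are independent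
of `h`. -/
theorem exists_norm_mulLp_shiftSymbol_le (H : IsWaveSymbol k w C)
    (S : IsSpectralSolution k w hg g0 u Y r) {A B : L2C}
    (hA : A =ᵐ[volume] fun η => k η • fourierR (u 0) η)
    (hB : B =ᵐ[volume] fun η => ((absSymbol η)⁻¹ * w η) • Y 0 η) :
    ∃ K, 0 ≤ K ∧ ∀ h : ℝ, ∀ t ∈ Icc 0 r,
      ‖mulLp (shiftSymbol h) (fourierR (u t))‖ ≤ K * |h| := by
  have hC := H.nonneg
  set D : ℝ := (C * ‖A‖) ^ 2 + (C * ‖B‖) ^ 2 with hD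
  set b : ℝ := Real.exp r * (C * c) ^ 2 with hb
  refine ⟨√(Real.exp r * D * Real.exp (b * r)), Real.sqrt_nonneg _, fun h => ?_⟩
  set m := shiftSymbol h with hm
  have hm1 := memLp_shiftSymbol h
  have hm2 := isAnnularSymbol_shiftSymbol h
  have hN : ContinuousOn (fun t => ‖mulLp m (fourierR (u t))‖ ^ 2) (Icc 0 r) :=
    (((mulLp m).continuous.comp continuous_fourierR).norm.pow 2).comp_continuousOn S.continuousOn_u
  have hinit : ∀ n, truncEnergy k w m n (u 0) (Y 0) ≤ h ^ 2 * D := by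
    intro n
    have h1 : ‖trunc n m (fourierR (u 0))‖ ≤ (|h| * C) * ‖A‖ := by
      refine norm_trunc_le_of_ae hm2 (by positivity) ?_ n
      filter_upwards [hA] with η h1
      rw [h1, norm_smul, ← mul_assoc, Real.norm_of_nonneg (H.pos η).le,
        abs_of_nonneg (shiftSymbol_nonneg h η)]
      refine mul_le_mul_of_nonneg_right ?_ (norm_nonneg _)
      calc m η ≤ |h| * absSymbol η := shiftSymbol_le h η
        _ ≤ |h| * (C * k η) := mul_le_mul_of_nonneg_left (H.le η) (abs_nonneg _)
        _ = _ := by ring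
    have h2 : ‖trunc n (fun η => m η * (absSymbol η * k η)⁻¹ * w η) (Y 0)‖ ≤ (|h| * C) * ‖B‖ := by
      refine norm_trunc_le_of_ae ((hm2.mul H.symbol_inv_freq).mul H.symbol_w) (by positivity) ?_ n
      filter_upwards [hB, ae_ne_zero] with η h1 hη
      have ha := absSymbol_pos hη
      have hk := H.pos η
      rw [h1, norm_smul, ← mul_assoc, norm_mul, abs_mul, abs_mul,
        abs_of_nonneg (shiftSymbol_nonneg h η), Real.norm_eq_abs, Real.norm_eq_abs,
        abs_of_pos (inv_pos.2 ha), abs_of_pos (inv_pos.2 (mul_pos ha hk)), ← mul_assoc]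
      refine mul_le_mul_of_nonneg_right ?_ (norm_nonneg _)
      refine mul_le_mul_of_nonneg_right ?_ (abs_nonneg _)
      calc m η * (absSymbol η * k η)⁻¹ ≤ |h| * absSymbol η * (absSymbol η * k η)⁻¹ := by
            gcongr; exact shiftSymbol_le h η
        _ = |h| * (k η)⁻¹ := by field_simp
        _ ≤ |h| * (C * (absSymbol η)⁻¹) := by gcongr; exact H.inv_k_le hη
        _ = _ := by ring
    calc truncEnergy k w m n (u 0) (Y 0) ≤ ((|h| * C) * ‖A‖) ^ 2 + ((|h| * C) * ‖B‖) ^ 2 := by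
          unfold truncEnergy; gcongr
      _ = |h| ^ 2 * D := by rw [hD]; ring
      _ = _ := by rw [sq_abs]
  have hstep : ∀ n, ∀ t ∈ Icc 0 r, ‖trunc n m (fourierR (u t))‖ ^ 2
      ≤ Real.exp r * (h ^ 2 * D) + b * ∫ τ in (0 : ℝ)..t, ‖mulLp m (fourierR (u τ))‖ ^ 2 := by
    intro n t ht
    have hG := le_exp_mul_add_integral (continuousOn_truncEnergy S m n)
      (b := fun t => (C * c) ^ 2 * ‖mulLp m (fourierR (u t))‖ ^ 2)
      (continuousOn_const.mul hN) (fun t _ => by positivity)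
      (fun t ht => hasDerivAt_truncEnergy H S hm2 n ht) (fun t ht => ?_) t ht
    · rw [intervalIntegral.integral_const_mul] at hG
      have hint : 0 ≤ ∫ τ in (0 : ℝ)..t, ‖mulLp m (fourierR (u τ))‖ ^ 2 :=
        intervalIntegral.integral_nonneg ht.1 fun τ _ => by positivity
      calc ‖trunc n m (fourierR (u t))‖ ^ 2 ≤ truncEnergy k w m n (u t) (Y t) :=
            le_add_of_nonneg_right (by positivity)
        _ ≤ _ := hG
        _ ≤ Real.exp r * (h ^ 2 * D
            + (C * c) ^ 2 * ∫ τ in (0 : ℝ)..t, ‖mulLp m (fourierR (u τ))‖ ^ 2) := by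
          gcongr
          · have h0 : 0 ≤ truncEnergy k w m n (u 0) (Y 0) := by unfold truncEnergy; positivity
            positivity
          · exact ht.2
          · exact hinit n
        _ = _ := by rw [hb]; ring
    · refine (neg_two_mul_inner_le _ _).trans (add_le_add
        (le_add_of_nonneg_left (by positivity)) ?_)
      rw [← mul_pow]
      refine pow_le_pow_left₀ (norm_nonneg _) ?_ 2
      refine (norm_trunc_mul_le hm1 hm2 (isAnnularSymbol_absSymbol.mul H.symbol_inv_k) hC
        (fun η hη => ?_) n _).trans ?_
      · have ha := absSymbol_pos hη
        have hk := H.pos η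
        rw [abs_of_pos (by positivity), ← div_eq_mul_inv, div_le_iff₀ hk]
        exact H.le η
      · rw [mul_assoc]
        exact mul_le_mul_of_nonneg_left (norm_mulLp_shiftSymbol_fourierComp_le hg g0 h (u t)) hC
  have hlim : ∀ t ∈ Icc 0 r, ‖mulLp m (fourierR (u t))‖ ^ 2
      ≤ Real.exp r * (h ^ 2 * D) + b * ∫ τ in (0 : ℝ)..t, ‖mulLp m (fourierR (u τ))‖ ^ 2 := by
    intro t ht
    have := (tendsto_trunc_one (mulLp m (fourierR (u t)))).norm.pow 2
    refine le_of_tendsto' this fun n => ?_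
    rw [trunc_one_mulLp hm1 hm2]
    exact hstep n t ht
  intro t ht
  have hfin := le_mul_exp_of_le_add_integral (by positivity) hN hlim t ht
  have hfin' : ‖mulLp m (fourierR (u t))‖ ^ 2
      ≤ (√(Real.exp r * D * Real.exp (b * r)) * |h|) ^ 2 := by
    rw [mul_pow, Real.sq_sqrt (by positivity), sq_abs]
    calc _ ≤ _ := hfin
      _ ≤ Real.exp r * (h ^ 2 * D) * Real.exp (b * r) := by
        gcongr
        exact ht.2
      _ = _ := by ring
  exact le_of_sq_le_sq hfin' (by positivity)

end Energy

/-! ### Conservation of energy -/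

section Conservation

variable {k w : ℝ → ℝ} {C : ℝ} {g : ℝ → ℝ} {c : ℝ≥0} {hg : LipschitzWith c g} {g0 : g 0 = 0}
  {u : ℝ → L2R} {Y : ℝ → L2C} {r : ℝ}

theorem truncEnergy_self (H : IsWaveSymbol k w C) (n : ℕ) (v : L2R) (y : L2C) :
    truncEnergy k w k n v y
      = ‖trunc n k (fourierR v)‖ ^ 2 + ‖trunc n (fun η => (absSymbol η)⁻¹ * w η) y‖ ^ 2 := by
  rw [truncEnergy, trunc_congr n (a := fun η => k η * (absSymbol η * k η)⁻¹ * w η)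
    (b := fun η => (absSymbol η)⁻¹ * w η) fun η hη => ?_]
  have := (absSymbol_pos hη).ne'
  have := (H.pos η).ne'
  field_simp

theorem hasDerivAt_truncEnergy_self (H : IsWaveSymbol k w C)
    (S : IsSpectralSolution k w hg g0 u Y r) (n : ℕ) {t : ℝ} (ht : t ∈ Ioo 0 r) :
    HasDerivAt (fun t => truncEnergy k w k n (u t) (Y t))
      (-2 * ⟪trunc n (fun η => (absSymbol η)⁻¹ * w η) (Y t),
        trunc n absSymbol (fourierComp hg g0 (u t))⟫_ℝ) t := by
  refine (hasDerivAt_truncEnergy H S H.symbol_k n ht).congr_deriv ?_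
  rw [trunc_congr n (a := fun η => k η * (absSymbol η * k η)⁻¹ * w η)
      (b := fun η => (absSymbol η)⁻¹ * w η) fun η hη => ?_,
    trunc_congr n (a := fun η => k η * (absSymbol η * (k η)⁻¹)) (b := absSymbol) fun η hη => ?_]
  · have := (H.pos η).ne'
    field_simp
  · have := (absSymbol_pos hη).ne'
    have := (H.pos η).ne'
    field_simp

theorem IsWaveSymbol.symbol_velocity (H : IsWaveSymbol k w C) :
    IsAnnularSymbol (fun η => (absSymbol η)⁻¹ * w η) :=
  isAnnularSymbol_inv_absSymbol.mul H.symbol_w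

/-- The energy norm stays finite. -/
theorem exists_norm_trunc_le (H : IsWaveSymbol k w C)
    (S : IsSpectralSolution k w hg g0 u Y r) {A B : L2C}
    (hA : A =ᵐ[volume] fun η => k η • fourierR (u 0) η)
    (hB : B =ᵐ[volume] fun η => ((absSymbol η)⁻¹ * w η) • Y 0 η) {K : ℝ}
    (hK : ∀ h : ℝ, ∀ t ∈ Icc 0 r, ‖mulLp (shiftSymbol h) (fourierR (u t))‖ ≤ K * |h|) :
    ∃ M, 0 ≤ M ∧ ∀ n, ∀ t ∈ Icc 0 r, ‖trunc n k (fourierR (u t))‖ ≤ M ∧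
      ‖trunc n (fun η => (absSymbol η)⁻¹ * w η) (Y t)‖ ≤ M := by
  set b : ℝ := (2 * (c * K)) ^ 2 with hb
  set M2 : ℝ := Real.exp r * (‖A‖ ^ 2 + ‖B‖ ^ 2 + r * b) with hM2
  refine ⟨√M2, Real.sqrt_nonneg _, fun n t ht => ?_⟩
  have h0r : 0 ≤ r := ht.1.trans ht.2
  have h0 : truncEnergy k w k n (u 0) (Y 0) ≤ ‖A‖ ^ 2 + ‖B‖ ^ 2 := by
    have e1 := trunc_of_ae_eq (isAnnularSymbol_const 1) H.symbol_k hA n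
    have e2 := trunc_of_ae_eq (isAnnularSymbol_const 1) H.symbol_velocity hB n
    simp only [one_mul] at e1 e2
    rw [truncEnergy_self H, ← e1, ← e2]
    gcongr <;> exact norm_trunc_one_le _ _
  have hG := le_exp_mul_add_integral (continuousOn_truncEnergy S k n) (b := fun _ => b)
    continuousOn_const (fun t _ => by positivity)
    (fun t ht => hasDerivAt_truncEnergy_self H S n ht) (fun t ht => ?_) t ht
  · have hE : truncEnergy k w k n (u t) (Y t) ≤ M2 := by
      refine hG.trans ?_
      rw [intervalIntegral.integral_const, sub_zero, smul_eq_mul]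
      have h1 : 0 ≤ truncEnergy k w k n (u 0) (Y 0) := by unfold truncEnergy; positivity
      have ht0 := ht.1
      have ht1 := ht.2
      have : 0 ≤ b := by positivity
      rw [hM2]
      gcongr
    rw [truncEnergy_self H] at hE
    constructor <;> refine Real.le_sqrt_of_sq_le (le_trans ?_ hE)
    · exact le_add_of_nonneg_right (by positivity)
    · exact le_add_of_nonneg_left (by positivity)
  · refine (neg_two_mul_inner_le _ _).trans ?_
    rw [truncEnergy_self H]
    refine add_le_add (le_add_of_nonneg_left (by positivity)) ?_
    have := norm_trunc_absSymbol_fourierComp_le hg g0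
      (fun h => hK h t (Ioo_subset_Icc_self ht)) n
    rw [reL2_symm_fourierR] at this
    exact pow_le_pow_left₀ (norm_nonneg _) this 2

/-- The frequency truncation of a real-valued function. -/
def lowFreq (n : ℕ) (v : L2R) : L2R := reL2 (fourierL2.symm (trunc n (fun _ => 1) (fourierR v)))

theorem continuous_lowFreq (n : ℕ) : Continuous (lowFreq n) :=
  reL2.continuous.comp (fourierL2.symm.continuous.comp
    ((trunc n _).continuous.comp continuous_fourierR))

theorem tendsto_lowFreq (v : L2R) : Tendsto (fun n => lowFreq n v) atTop (𝓝 v) := by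
  have := ((reL2.continuous.comp fourierL2.symm.continuous).tendsto _).comp
    (tendsto_trunc_one (fourierR v))
  rw [Function.comp_apply, reL2_symm_fourierR] at this
  exact this

theorem hasDerivAt_lowFreq (S : IsSpectralSolution k w hg g0 u Y r) (n : ℕ) {t : ℝ}
    (ht : t ∈ Ioo 0 r) :
    HasDerivAt (fun τ => lowFreq n (u τ)) (reL2 (fourierL2.symm (trunc n w (Y t)))) t := by
  have h := S.hasDerivAt_u n _ (isAnnularSymbol_const 1) t ht
  simp only [one_mul] at h
  exact (reL2.comp fourierL2.symm.toContinuousLinearEquiv.toContinuousLinearMap).hasFDerivAt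
    |>.comp_hasDerivAt t h

/-- The error in the energy balance of the low frequencies. -/
def energyDefect (w : ℝ → ℝ) (hg : LipschitzWith c g) (g0 : g 0 = 0) (n : ℕ) (v : L2R) (y : L2C) :
    ℝ :=
  -2 * ⟪trunc n (fun η => (absSymbol η)⁻¹ * w η) y,
    trunc n absSymbol (fourierComp hg g0 v - fourierComp hg g0 (lowFreq n v))⟫_ℝ

theorem hasDerivAt_truncEnergy_add_integral (H : IsWaveSymbol k w C)
    (S : IsSpectralSolution k w hg g0 u Y r) (n : ℕ) {t : ℝ} (ht : t ∈ Ioo 0 r) :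
    HasDerivAt (fun t => truncEnergy k w k n (u t) (Y t)
        + 2 * ∫ x, primitive g (lowFreq n (u t) x))
      (energyDefect w hg g0 n (u t) (Y t)) t := by
  have h1 := hasDerivAt_truncEnergy_self H S n ht
  have h2 := ((hasFDerivAt_integral_primitive hg g0 (lowFreq n (u t))).comp_hasDerivAt t
    (hasDerivAt_lowFreq S n ht)).const_mul 2
  refine (h1.add h2).congr_deriv ?_
  have e1 : trunc n w (Y t)
      = trunc n absSymbol (trunc n (fun η => (absSymbol η)⁻¹ * w η) (Y t)) := by
    rw [trunc_trunc isAnnularSymbol_absSymbol H.symbol_velocity]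
    refine congrArg (· (Y t)) (trunc_congr n fun η hη => ?_)
    have := (absSymbol_pos hη).ne'
    field_simp
  have e2 : ⟪hg.compLp g0 (lowFreq n (u t)), reL2 (fourierL2.symm (trunc n w (Y t)))⟫_ℝ
      = ⟪trunc n (fun η => (absSymbol η)⁻¹ * w η) (Y t),
        trunc n absSymbol (fourierComp hg g0 (lowFreq n (u t)))⟫_ℝ := by
    rw [inner_reL2_right, ← fourierL2.inner_map_map, LinearIsometryEquiv.apply_symm_apply, e1,
      ← inner_trunc_left isAnnularSymbol_absSymbol, real_inner_comm]
    rfl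
  rw [innerSL_apply_apply, e2, energyDefect, map_sub, inner_sub_right]
  ring

/-- The energy balance defect of the low frequencies tends to zero: `∂ₓ (g(u) - g(u_n))` is bounded
in `L²`, and converges to zero weakly because `g(u_n) → g(u)` in `L²`. -/
theorem tendsto_energyDefect (H : IsWaveSymbol k w C) {v : L2R} {y B : L2C} {K : ℝ}
    (hB : B =ᵐ[volume] fun η => ((absSymbol η)⁻¹ * w η) • y η)
    (hK : ∀ n, ‖trunc n absSymbol
      (fourierComp hg g0 v - fourierComp hg g0 (lowFreq n v))‖ ≤ K) :
    Tendsto (fun n => energyDefect w hg g0 n v y) atTop (𝓝 0) := by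
  set e : ℕ → L2C := fun n =>
    trunc n absSymbol (fourierComp hg g0 v - fourierComp hg g0 (lowFreq n v)) with he
  have h1 := isAnnularSymbol_const 1
  have ha := isAnnularSymbol_absSymbol
  have key : ∀ n, energyDefect w hg g0 n v y = -2 * ⟪B, e n⟫_ℝ := by
    intro n
    have h2 := trunc_of_ae_eq h1 H.symbol_velocity hB n
    simp only [one_mul] at h2
    rw [energyDefect, ← h2, inner_trunc_left h1, trunc_trunc h1 ha]
    simp only [one_mul, he]
  -- Against a fixed annulus `∂ₓ` is bounded, so that strong convergence `g(u_n) → g(u)` suffices.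
  have hlow : ∀ m, Tendsto (fun n => ⟪trunc m (fun _ => 1) B, e n⟫_ℝ) atTop (𝓝 0) := by
    intro m
    have h3 : ∀ᶠ n in atTop, ⟪trunc m absSymbol B,
        fourierComp hg g0 v - fourierComp hg g0 (lowFreq n v)⟫_ℝ
          = ⟪trunc m (fun _ => 1) B, e n⟫_ℝ := by
      filter_upwards [eventually_ge_atTop m] with n hn
      rw [he, ← inner_trunc_left ha, trunc_trunc_min ha h1, min_eq_right hn]
      simp only [mul_one]
    refine Tendsto.congr' h3 ?_
    have h4 := ((continuous_fourierComp hg g0).tendsto v).comp (tendsto_lowFreq v)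
    have h5 := (tendsto_const_nhds (x := trunc m absSymbol B)).inner (𝕜 := ℝ)
      ((tendsto_const_nhds (x := fourierComp hg g0 v)).sub h4)
    simpa using h5
  have hK0 : 0 ≤ K := (norm_nonneg _).trans (hK 0)
  have hmain : Tendsto (fun n => ⟪B, e n⟫_ℝ) atTop (𝓝 0) := by
    rw [Metric.tendsto_atTop]
    intro ε hε
    obtain ⟨m, hm⟩ := ((Metric.tendsto_atTop.1 (tendsto_trunc_one B)) (ε / (2 * (K + 1)))
      (by positivity))
    have hm := hm m le_rfl
    obtain ⟨N, hN⟩ := (Metric.tendsto_atTop.1 (hlow m)) (ε / 2) (by positivity)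
    refine ⟨N, fun n hn => ?_⟩
    have h6 := hN n hn
    rw [dist_zero_right, Real.norm_eq_abs] at h6 ⊢
    rw [dist_comm, dist_eq_norm, lt_div_iff₀ (by positivity)] at hm
    have h7 : |⟪B - trunc m (fun _ => 1) B, e n⟫_ℝ| ≤ ‖B - trunc m (fun _ => 1) B‖ * K :=
      (abs_real_inner_le_norm _ _).trans (mul_le_mul_of_nonneg_left (hK n) (norm_nonneg _))
    have h8 : ⟪B, e n⟫_ℝ = ⟪B - trunc m (fun _ => 1) B, e n⟫_ℝ
        + ⟪trunc m (fun _ => 1) B, e n⟫_ℝ := by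
      rw [inner_sub_left]; ring
    rw [h8]
    have h9 := norm_nonneg (B - trunc m (fun _ => 1) B)
    refine (abs_add_le _ _).trans_lt ?_
    nlinarith
  have := hmain.const_mul (-2)
  rw [mul_zero] at this
  exact this.congr fun n => (key n).symm

/-- Conservation of the energy on the Fourier side, with a Lipschitz nonlinearity. -/
theorem IsSpectralSolution.energy_eq (H : IsWaveSymbol k w C)
    (S : IsSpectralSolution k w hg g0 u Y r) (hr : 0 ≤ r) {A B : L2C}
    (hA : A =ᵐ[volume] fun η => k η • fourierR (u 0) η)
    (hB : B =ᵐ[volume] fun η => ((absSymbol η)⁻¹ * w η) • Y 0 η) :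
    ∃ A' B' : L2C, (A' =ᵐ[volume] fun η => k η • fourierR (u r) η) ∧
      (B' =ᵐ[volume] fun η => ((absSymbol η)⁻¹ * w η) • Y r η) ∧
      ‖B'‖ ^ 2 + ‖A'‖ ^ 2 + 2 * ∫ x, primitive g (u r x)
        = ‖B‖ ^ 2 + ‖A‖ ^ 2 + 2 * ∫ x, primitive g (u 0 x) := by
  obtain ⟨K, hK0, hK⟩ := exists_norm_mulLp_shiftSymbol_le H S hA hB
  obtain ⟨M, hM0, hM⟩ := exists_norm_trunc_le H S hA hB hK
  have hAt : ∀ t ∈ Icc 0 r, ∃ A' : L2C, A' =ᵐ[volume] fun η => k η • fourierR (u t) η :=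
    fun t ht => (exists_ae_eq_of_norm_trunc_le H.symbol_k fun n => (hM n t ht).1).imp
      fun _ h => h.1
  have hBt : ∀ t ∈ Icc 0 r, ∃ B' : L2C,
      B' =ᵐ[volume] fun η => ((absSymbol η)⁻¹ * w η) • Y t η :=
    fun t ht => (exists_ae_eq_of_norm_trunc_le H.symbol_velocity fun n => (hM n t ht).2).imp
      fun _ h => h.1
  have hdiff : ∀ n, ∀ t ∈ Icc 0 r, ‖trunc n absSymbol
      (fourierComp hg g0 (u t) - fourierComp hg g0 (lowFreq n (u t)))‖ ≤ 4 * (c * K) := by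
    intro n t ht
    have h1 := norm_trunc_absSymbol_fourierComp_le hg g0 (fun h => hK h t ht) n
    rw [reL2_symm_fourierR] at h1
    have h2 : ‖trunc n absSymbol (fourierComp hg g0 (lowFreq n (u t)))‖ ≤ 2 * (c * K) := by
      refine norm_trunc_absSymbol_fourierComp_le hg g0 (fun h => ?_) n
      rw [mulLp_trunc_one (memLp_shiftSymbol h)]
      exact (norm_trunc_one_le n _).trans (hK h t ht)
    rw [map_sub]
    refine (norm_sub_le _ _).trans ?_
    linarith
  have hdefect : ∀ n, ∀ t ∈ Icc 0 r,
      ‖energyDefect w hg g0 n (u t) (Y t)‖ ≤ 2 * (M * (4 * (c * K))) := by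
    intro n t ht
    rw [energyDefect, norm_mul, norm_neg, Real.norm_two]
    refine mul_le_mul_of_nonneg_left ?_ zero_le_two
    exact (abs_real_inner_le_norm _ _).trans
      (mul_le_mul (hM n t ht).2 (hdiff n t ht) (norm_nonneg _) hM0)
  have hcont : ∀ n, ContinuousOn (fun t => energyDefect w hg g0 n (u t) (Y t)) (Icc 0 r) := by
    intro n
    refine continuousOn_const.mul (ContinuousOn.inner (𝕜 := ℝ) ?_ ?_)
    · exact (trunc n _).continuous.comp_continuousOn S.continuousOn_Y
    · refine (trunc n _).continuous.comp_continuousOn (ContinuousOn.sub ?_ ?_)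
      · exact (continuous_fourierComp hg g0).comp_continuousOn S.continuousOn_u
      · exact ((continuous_fourierComp hg g0).comp (continuous_lowFreq n)).comp_continuousOn
          S.continuousOn_u
  set Φ : ℕ → ℝ → ℝ := fun n t => truncEnergy k w k n (u t) (Y t)
    + 2 * ∫ x, primitive g (lowFreq n (u t) x) with hΦ
  have hint : ∀ n, ∫ t in (0 : ℝ)..r, energyDefect w hg g0 n (u t) (Y t) = Φ n r - Φ n 0 := by
    intro n
    refine intervalIntegral.integral_eq_sub_of_hasDerivAt_of_le hr ?_
      (fun t ht => hasDerivAt_truncEnergy_add_integral H S n ht)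
      ((hcont n).intervalIntegrable_of_Icc hr)
    refine (continuousOn_truncEnergy S k n).add (continuousOn_const.mul ?_)
    exact ((continuous_integral_primitive hg g0).comp (continuous_lowFreq n)).comp_continuousOn
      S.continuousOn_u
  have hzero : Tendsto (fun n => Φ n r - Φ n 0) atTop (𝓝 0) := by
    simp_rw [← hint]
    have h00 : 𝓝 (0 : ℝ) = 𝓝 (∫ t in (0 : ℝ)..r, (0 : ℝ)) := by simp
    rw [h00]
    have hsub : uIoc 0 r ⊆ Icc 0 r := by
      rw [uIoc_of_le hr]; exact Ioc_subset_Icc_self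
    refine intervalIntegral.tendsto_integral_filter_of_dominated_convergence
      (F := fun n t => energyDefect w hg g0 n (u t) (Y t)) (l := atTop) (μ := volume)
      (fun _ => 2 * (M * (4 * (c * K)))) ?_ ?_ intervalIntegrable_const ?_
    · exact Eventually.of_forall fun n =>
        ((hcont n).mono hsub).aestronglyMeasurable measurableSet_uIoc
    · exact Eventually.of_forall fun n => Eventually.of_forall fun t ht => hdefect n t (hsub ht)
    · refine Eventually.of_forall fun t ht => ?_
      obtain ⟨B', hB'⟩ := hBt t (hsub ht)
      exact tendsto_energyDefect H hB' fun n => hdiff n t (hsub ht)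
  have hlim : ∀ t, ∀ A' B' : L2C, (A' =ᵐ[volume] fun η => k η • fourierR (u t) η) →
      (B' =ᵐ[volume] fun η => ((absSymbol η)⁻¹ * w η) • Y t η) →
      Tendsto (fun n => Φ n t) atTop
        (𝓝 (‖A'‖ ^ 2 + ‖B'‖ ^ 2 + 2 * ∫ x, primitive g (u t x))) := by
    intro t A' B' hA' hB'
    refine Tendsto.add ?_ (Tendsto.const_mul 2 ?_)
    · have h1 := ((tendsto_trunc_one A').norm.pow 2).add ((tendsto_trunc_one B').norm.pow 2)
      refine h1.congr fun n => ?_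
      have e1 := trunc_of_ae_eq (isAnnularSymbol_const 1) H.symbol_k hA' n
      have e2 := trunc_of_ae_eq (isAnnularSymbol_const 1) H.symbol_velocity hB' n
      simp only [one_mul] at e1 e2
      rw [truncEnergy_self H, e1, e2]
    · exact ((continuous_integral_primitive hg g0).tendsto _).comp (tendsto_lowFreq (u t))
  obtain ⟨A', hA'⟩ := hAt r (right_mem_Icc.2 hr)
  obtain ⟨B', hB'⟩ := hBt r (right_mem_Icc.2 hr)
  refine ⟨A', B', hA', hB', ?_⟩
  have := tendsto_nhds_unique hzero ((hlim r A' B' hA' hB').sub (hlim 0 A B hA hB))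
  linarith

end Conservation

/-! ### Distributions whose Fourier transform is a function -/

theorem IsFunction.congr {f : 𝓢'(ℝ, ℂ)} {F F' : ℝ → ℂ} (h : IsFunction f F)
    (hF : F =ᵐ[volume] F') : IsFunction f F' := by
  intro θ
  have e : (fun x => θ x * F x) =ᵐ[volume] fun x => θ x * F' x := by
    filter_upwards [hF] with x hx
    rw [hx]
  exact ⟨(h θ).1.congr e, (h θ).2.trans (integral_congr_ae e)⟩

theorem isFunction_coe (f : L2C) : IsFunction (f : 𝓢'(ℝ, ℂ)) f := by
  intro θ
  refine ⟨?_, by simp⟩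
  exact (θ.memLp 2 volume).integrable_mul (Lp.memLp f)

theorem IsFunction.eq_coe {f : 𝓢'(ℝ, ℂ)} {F : ℝ → ℂ} (h : IsFunction f F) {v : L2C}
    (hv : v =ᵐ[volume] F) : f = (v : 𝓢'(ℝ, ℂ)) := by
  ext θ
  rw [(h θ).2, ((isFunction_coe v).congr hv θ).2]

theorem isFunction_smulLeftCLM {f : 𝓢'(ℝ, ℂ)} {F : ℝ → ℂ} (h : IsFunction f F) {W : ℝ → ℂ}
    (hW : W.HasTemperateGrowth) : IsFunction (smulLeftCLM ℂ W f) (fun η => W η * F η) := by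
  intro θ
  have e : ∀ η, SchwartzMap.smulLeftCLM ℂ W θ η * F η = θ η * (W η * F η) := by
    intro η
    rw [SchwartzMap.smulLeftCLM_apply_apply hW, smul_eq_mul]
    ring
  have h1 := h (SchwartzMap.smulLeftCLM ℂ W θ)
  simp_rw [e] at h1
  exact h1

theorem fourier_toDist (v : L2R) : 𝓕 (toDist v) = (fourierR v : 𝓢'(ℝ, ℂ)) :=
  Lp.fourier_toTemperedDistribution_eq (ofRealL2 v)

theorem fourier_derivCLM_derivCLM (f : 𝓢'(ℝ, ℂ)) :
    𝓕 (derivCLM ℂ (derivCLM ℂ f))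
      = smulLeftCLM ℂ (fun η => ((-absSymbol η ^ 2 : ℝ) : ℂ)) (𝓕 f) := by
  have e : ∀ f : 𝓢'(ℝ, ℂ), 𝓕 (derivCLM ℂ f)
      = smulLeftCLM ℂ (fun η : ℝ => (2 * Real.pi * Complex.I) • (η : ℂ)) (𝓕 f) := by
    intro f
    have e1 : derivCLM ℂ f = LineDeriv.lineDerivOp (1 : ℝ) f := by
      ext θ
      rw [derivCLM_apply_apply, lineDerivOp_apply_apply]
      congr 2
    have e2 : (fun η : ℝ => (2 * Real.pi * Complex.I) • (η : ℂ))
        = (2 * Real.pi * Complex.I) • (fun η : ℝ => ((inner ℝ η 1 : ℝ) : ℂ)) := by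
      ext η
      simp
    rw [e1, fourier_lineDerivOp_eq, e2, smulLeftCLM_smul (by fun_prop)]
    simp
  rw [e, e, smulLeftCLM_smulLeftCLM_apply (by fun_prop) (by fun_prop)]
  congr 2
  ext η
  simp only [Pi.mul_apply, absSymbol, sq_abs]
  push_cast
  simp only [smul_eq_mul]
  ring_nf
  rw [Complex.I_sq]
  ring

/-! ### Bessel potentials -/

/-- The symbol `(1 + η²)^(-s/2)` of the inverse of the Bessel potential of order `s`. -/
def besselWeight (s : ℝ) (η : ℝ) : ℝ := (1 + ‖η‖ ^ 2) ^ (-s / 2)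

theorem besselWeight_pos (s η : ℝ) : 0 < besselWeight s η := by
  unfold besselWeight; positivity

theorem besselWeight_mul (s s' η : ℝ) :
    besselWeight s η * besselWeight s' η = besselWeight (s + s') η := by
  unfold besselWeight
  rw [← Real.rpow_add (by positivity)]
  congr 1
  ring

theorem besselWeight_zero (η : ℝ) : besselWeight 0 η = 1 := by
  simp [besselWeight]

theorem besselWeight_le_one {s : ℝ} (hs : 0 ≤ s) (η : ℝ) : besselWeight s η ≤ 1 :=
  Real.rpow_le_one_of_one_le_of_nonpos (le_add_of_nonneg_right (by positivity)) (by linarith)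

theorem hasTemperateGrowth_besselWeight (s : ℝ) : (besselWeight s).HasTemperateGrowth :=
  Function.hasTemperateGrowth_one_add_norm_sq_rpow ℝ (-s / 2)

theorem hasTemperateGrowth_besselWeight_ofReal (s : ℝ) :
    (fun η => (besselWeight s η : ℂ)).HasTemperateGrowth := by
  have := hasTemperateGrowth_besselWeight s
  fun_prop

theorem continuous_besselWeight (s : ℝ) : Continuous (besselWeight s) :=
  (hasTemperateGrowth_besselWeight s).1.continuous

theorem isAnnularSymbol_besselWeight (s : ℝ) : IsAnnularSymbol (besselWeight s) :=
  isAnnularSymbol_of_continuousOn (continuous_besselWeight s).measurable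
    (continuous_besselWeight s).continuousOn

theorem memLp_besselWeight {s : ℝ} (hs : 0 ≤ s) :
    MemLp (besselWeight s) ∞ (volume : Measure ℝ) :=
  memLp_top_of_bound (continuous_besselWeight s).aestronglyMeasurable 1
    (Eventually.of_forall fun η => by
      rw [Real.norm_of_nonneg (besselWeight_pos s η).le]; exact besselWeight_le_one hs η)

theorem isFunction_fourier_of_besselPotential_eq {s : ℝ} {f : 𝓢'(ℝ, ℂ)} {F : L2C}
    (h : besselPotential ℝ ℂ s f = (F : 𝓢'(ℝ, ℂ))) :
    IsFunction (𝓕 f) (fun η => besselWeight s η • fourierL2 F η) := by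
  have h1 := (besselPotential_neg_apply_eq_iff s (F : 𝓢'(ℝ, ℂ)) f).2 h
  rw [← h1, fourier_besselPotential_eq_smulLeftCLM_fourier_apply,
    Lp.fourier_toTemperedDistribution_eq]
  exact isFunction_smulLeftCLM (isFunction_coe _) (hasTemperateGrowth_besselWeight_ofReal s)

theorem fourierR_ae_eq_of_besselPotential_eq {s : ℝ} {v : L2R} {F : L2C}
    (h : besselPotential ℝ ℂ s (toDist v) = (F : 𝓢'(ℝ, ℂ))) :
    fourierR v =ᵐ[volume] fun η => besselWeight s η • fourierL2 F η := by
  have h1 := isFunction_fourier_of_besselPotential_eq h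
  rw [fourier_toDist] at h1
  exact (isFunction_coe _).ae_eq h1

theorem memLp_two_besselWeight {s : ℝ} (hs : 1 / 2 < s) :
    MemLp (besselWeight s) 2 (volume : Measure ℝ) := by
  rw [memLp_two_iff_integrable_sq (continuous_besselWeight s).aestronglyMeasurable]
  have := integrable_rpow_neg_one_add_norm_sq (E := ℝ) (μ := volume) (r := s + s)
    (by rw [Module.finrank_self]; push_cast; linarith)
  refine this.congr (Eventually.of_forall fun η => ?_)
  change besselWeight (s + s) η = _
  rw [← besselWeight_mul]
  exact (sq _).symm

/-- The Sobolev embedding `H^s ⊂ L^∞` for `s > 1/2`. -/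
theorem ae_abs_le_of_besselPotential_eq {s : ℝ} (hs : 1 / 2 < s) {v : L2R} {F : L2C}
    (h : besselPotential ℝ ℂ s (toDist v) = (F : 𝓢'(ℝ, ℂ))) :
    ∀ᵐ x, |v x| ≤ ‖(memLp_two_besselWeight hs).toLp‖ * ‖F‖ := by
  set b : L2R := (memLp_two_besselWeight hs).toLp with hb
  have hv := fourierR_ae_eq_of_besselPotential_eq h
  have hint : Integrable (fun η => besselWeight s η • fourierL2 F η) :=
    memLp_one_iff_integrable.1 ((Lp.memLp (fourierL2 F)).smul (memLp_two_besselWeight hs))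
  have hint' : Integrable (fourierR v) := hint.congr hv.symm
  have hbound : ∫ η, ‖fourierR v η‖ ≤ ‖b‖ * ‖F‖ := by
    set N : L2R := (Lp.memLp (fourierL2 F)).norm.toLp with hN
    have hNF : ‖N‖ ≤ ‖F‖ := by
      rw [← fourierL2.norm_map F]
      refine Lp.norm_le_norm_of_ae_le ?_
      filter_upwards [(Lp.memLp (fourierL2 F)).norm.coeFn_toLp] with η h1
      rw [hN, h1, norm_norm]
    refine le_trans (le_of_eq ?_) ((real_inner_le_norm b N).trans
      (mul_le_mul_of_nonneg_left hNF (norm_nonneg _)))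
    rw [L2.inner_def]
    refine integral_congr_ae ?_
    filter_upwards [hv, (Lp.memLp (fourierL2 F)).norm.coeFn_toLp,
      (memLp_two_besselWeight hs).coeFn_toLp] with η h1 h2 h3
    rw [h1, hN, hb, h2, h3, norm_smul, Real.norm_of_nonneg (besselWeight_pos s η).le]
    simp [mul_comm]
  have hle : ∀ x, ‖𝓕⁻ (fourierR v : ℝ → ℂ) x‖ ≤ ‖b‖ * ‖F‖ := by
    intro x
    rw [Real.fourierInv_eq]
    refine (norm_integral_le_integral_norm _).trans (le_trans (le_of_eq ?_) hbound)
    refine integral_congr_ae (Eventually.of_forall fun η => ?_)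
    exact Circle.norm_smul _ _
  have hfun : IsFunction (toDist v) (𝓕⁻ (fourierR v : ℝ → ℂ)) := by
    intro θ
    have hcont : Continuous (𝓕⁻ (fourierR v : ℝ → ℂ)) := by
      rw [← Real.Lp.fourierTransformInv_toLp (memLp_one_iff_integrable.2 hint')]
      exact BoundedContinuousFunction.continuous _
    refine ⟨(θ.integrable (μ := volume)).mul_bdd (c := ‖b‖ * ‖F‖) hcont.aestronglyMeasurable
      (Eventually.of_forall hle), ?_⟩
    have h1 : toDist v θ = ∫ η, 𝓕⁻ θ η • fourierR v η := by
      have h2 := (isFunction_coe (fourierR v) (𝓕⁻ θ)).2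
      rw [← fourier_toDist, TemperedDistribution.fourier_apply,
        FourierTransform.fourier_fourierInv_eq] at h2
      exact h2
    have hflip : (-innerₗ ℝ : ℝ →ₗ[ℝ] ℝ →ₗ[ℝ] ℝ).flip = -innerₗ ℝ := by
      ext
      simp
    have h3 := VectorFourier.integral_fourierIntegral_smul_eq_flip (μ := volume) (ν := volume)
      (L := -innerₗ ℝ) Real.continuous_fourierChar
      (continuous_inner (𝕜 := ℝ) (E := ℝ)).neg
      (θ.integrable (μ := volume)) hint'
    rw [hflip] at h3
    rw [h1, SchwartzMap.fourierInv_coe]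
    exact h3
  have hae := (isFunction_coe (ofRealL2 v)).ae_eq hfun
  filter_upwards [hae, coeFn_ofRealL2 v] with x h1 h2
  have := hle x
  rwa [← h1, h2, Complex.norm_real] at this

/-! ### From weak to strong derivatives -/

/-- If a curve in `L²` has a continuous derivative when tested with Schwartz functions, then it is
differentiable in `L²`. -/
theorem hasDerivAt_of_forall_schwartz {y W : ℝ → L2C} {r : ℝ} (hW : ContinuousOn W (Ioo 0 r))
    (h : ∀ χ : 𝓢(ℝ, ℂ), ∀ t ∈ Ioo 0 r,
      HasDerivAt (fun τ => (y τ : 𝓢'(ℝ, ℂ)) χ) ((W t : 𝓢'(ℝ, ℂ)) χ) t) :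
    ∀ t ∈ Ioo 0 r, HasDerivAt y (W t) t := by
  intro t ht
  have hint : ∀ τ ∈ Ioo 0 r, IntervalIntegrable W volume t τ := fun τ hτ =>
    (hW.mono (ordConnected_Ioo.uIcc_subset ht hτ)).intervalIntegrable
  have hId : ∀ τ ∈ Ioo 0 r, HasDerivAt (fun τ => ∫ σ in t..τ, W σ) (W τ) τ := fun τ hτ =>
    intervalIntegral.integral_hasDerivAt_right (hint τ hτ)
      (hW.stronglyMeasurableAtFilter isOpen_Ioo τ hτ)
      (hW.continuousAt (isOpen_Ioo.mem_nhds hτ))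
  have hconst : ∀ τ ∈ Ioo 0 r, y τ = y t + ∫ σ in t..τ, W σ := by
    intro τ hτ
    have hker := LinearMap.ker_eq_bot.1
      (Lp.ker_toTemperedDistributionCLM_eq_bot (F := ℂ) (μ := (volume : Measure ℝ)) (p := 2))
    refine hker ?_
    ext χ
    set e : L2C →L[ℂ] ℂ := (PointwiseConvergenceCLM.evalCLM (RingHom.id ℂ) ℂ χ).comp
      (Lp.toTemperedDistributionCLM ℂ (volume : Measure ℝ) 2) with he
    have hd : ∀ σ ∈ Ioo 0 r, HasDerivAt (fun σ => e (y σ) - e (∫ ν in t..σ, W ν)) 0 σ := by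
      intro σ hσ
      have h1 := (e.restrictScalars ℝ).hasFDerivAt.comp_hasDerivAt σ (hId σ hσ)
      have h2 := (h χ σ hσ).sub h1
      refine h2.congr_deriv ?_
      exact sub_self _
    have hc := isOpen_Ioo.is_const_of_deriv_eq_zero isPreconnected_Ioo
      (fun σ hσ => (hd σ hσ).differentiableAt.differentiableWithinAt)
      (fun σ hσ => (hd σ hσ).deriv) hτ ht
    simp only [intervalIntegral.integral_same, map_zero, sub_zero] at hc
    change e (y τ) = e (y t + ∫ σ in t..τ, W σ)
    rw [map_add, ← hc]
    ring
  refine ((hId t ht).const_add (y t)).congr_of_eventuallyEq ?_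
  filter_upwards [isOpen_Ioo.mem_nhds ht] with τ hτ
  exact hconst τ hτ

/-! ### The symbol of `L` -/

theorem absSymbol_sq_le (η : ℝ) : absSymbol η ^ 2 ≤ (2 * Real.pi) ^ 2 * besselWeight (-2) η := by
  have e : besselWeight (-2) η = 1 + η ^ 2 := by simp [besselWeight]
  rw [e, absSymbol, sq_abs]
  nlinarith [sq_nonneg (2 * Real.pi), Real.pi_pos]

theorem kSymbol_sq_le {l : ℝ → ℝ} {ρ c₂ : ℝ} (hρ : 0 ≤ ρ) (hpos : ∀ ξ, 0 ≤ l ξ)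
    (hle : ∀ ξ, l ξ ≤ c₂ ^ 2 * (1 + ξ ^ 2) ^ (ρ / 2)) (η : ℝ) :
    kSymbol l (2 * Real.pi * η) ^ 2
      ≤ c₂ ^ 2 * ((2 * Real.pi) ^ 2) ^ (ρ / 2) * besselWeight (-ρ) η := by
  rw [kSymbol, Real.sq_sqrt (hpos _)]
  refine (hle _).trans ?_
  rw [mul_assoc (c₂ ^ 2), besselWeight, neg_neg, Real.norm_eq_abs, sq_abs,
    ← Real.mul_rpow (by positivity) (by positivity)]
  refine mul_le_mul_of_nonneg_left ?_ (sq_nonneg _)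
  refine Real.rpow_le_rpow (by positivity) ?_ (by linarith)
  have : 1 ≤ (2 * Real.pi) ^ 2 := by nlinarith [Real.pi_gt_three]
  nlinarith

section Symbol

variable {l : ℝ → ℝ} {ρ : ℝ}

theorem IsEllipticCoercive.pos (h : IsEllipticCoercive l ρ) (ξ : ℝ) : 0 < l ξ := by
  obtain ⟨c₁, c₂, h₁, h₂, h⟩ := h
  exact lt_of_lt_of_le (by positivity) (h ξ).1

theorem measurable_kSymbol (hl : Measurable l) :
    Measurable (fun η => kSymbol l (2 * Real.pi * η)) :=
  (hl.comp (measurable_const_mul _)).sqrt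

theorem IsEllipticCoercive.exists_kSymbol_sq_le (h : IsEllipticCoercive l ρ) (hρ : 2 ≤ ρ) :
    ∃ D, 0 ≤ D ∧ ∀ η, kSymbol l (2 * Real.pi * η) ^ 2 ≤ D * besselWeight (-ρ) η := by
  have hpos := h.pos
  obtain ⟨c₁, c₂, h₁, h₂, h⟩ := h
  exact ⟨_, by positivity, kSymbol_sq_le (by linarith) (fun ξ => (hpos ξ).le) fun ξ => (h ξ).2⟩

/-- The symbol of `K` dominates that of `∂ₓ`, because `ρ ≥ 2`. -/
theorem IsEllipticCoercive.exists_isWaveSymbol (h : IsEllipticCoercive l ρ) (hl : Measurable l)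
    (hρ : 2 ≤ ρ) {w : ℝ → ℝ} (hw : IsAnnularSymbol w) :
    ∃ C, IsWaveSymbol (fun η => kSymbol l (2 * Real.pi * η)) w C := by
  have hpos := h.pos
  obtain ⟨D, hD, hk⟩ := h.exists_kSymbol_sq_le hρ
  obtain ⟨c₁, c₂, h₁, h₂, h⟩ := h
  refine ⟨c₁⁻¹, ?_, hw, fun η => Real.sqrt_pos.2 (hpos _), fun η => ?_⟩
  · have hc : Continuous fun η => √(D * besselWeight (-ρ) η) :=
      (continuous_const.mul (continuous_besselWeight _)).sqrt
    refine IsAnnularSymbol.of_abs_le (measurable_kSymbol hl)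
      (isAnnularSymbol_of_continuousOn hc.measurable hc.continuousOn) fun η _ => ?_
    rw [abs_of_nonneg (a := kSymbol l _) (Real.sqrt_nonneg _), abs_of_nonneg (Real.sqrt_nonneg _)]
    exact Real.le_sqrt_of_sq_le (hk η)
  · rw [inv_mul_eq_div, le_div_iff₀ h₁, mul_comm]
    refine Real.le_sqrt_of_sq_le ?_
    rw [mul_pow, absSymbol, sq_abs]
    refine le_trans ?_ (h (2 * Real.pi * η)).1
    refine mul_le_mul_of_nonneg_left ?_ (sq_nonneg _)
    calc (2 * Real.pi * η) ^ 2 ≤ 1 + (2 * Real.pi * η) ^ 2 := by linarith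
      _ = (1 + (2 * Real.pi * η) ^ 2) ^ (1 : ℝ) := (Real.rpow_one _).symm
      _ ≤ _ := Real.rpow_le_rpow_of_exponent_le (by linarith [sq_nonneg (2 * Real.pi * η)])
        (by linarith)

theorem memLp_besselWeight_mul_absSymbol_sq {N : ℝ} (hN : 2 ≤ N) :
    MemLp (fun η => besselWeight N η * absSymbol η ^ 2) ∞ (volume : Measure ℝ) := by
  refine memLp_top_of_bound
    ((continuous_besselWeight N).mul (continuous_absSymbol.pow 2)).aestronglyMeasurable
    ((2 * Real.pi) ^ 2) (Eventually.of_forall fun η => ?_)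
  have hp := besselWeight_pos N η
  rw [Real.norm_of_nonneg (by positivity)]
  calc besselWeight N η * absSymbol η ^ 2
      ≤ besselWeight N η * ((2 * Real.pi) ^ 2 * besselWeight (-2) η) := by
        gcongr; exact absSymbol_sq_le η
    _ = (2 * Real.pi) ^ 2 * besselWeight (N + -2) η := by rw [← besselWeight_mul]; ring
    _ ≤ (2 * Real.pi) ^ 2 * 1 := by gcongr; exact besselWeight_le_one (by linarith) η
    _ = _ := mul_one _

theorem IsEllipticCoercive.memLp_besselWeight_mul_sq (h : IsEllipticCoercive l ρ)
    (hl : Measurable l) (hρ : 2 ≤ ρ) {N : ℝ} (hN : ρ + 2 ≤ N) :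
    MemLp (fun η => besselWeight N η * (absSymbol η * kSymbol l (2 * Real.pi * η)) ^ 2) ∞
      (volume : Measure ℝ) := by
  obtain ⟨D, hD, hk⟩ := h.exists_kSymbol_sq_le hρ
  have hm : Measurable
      (fun η => besselWeight N η * (absSymbol η * kSymbol l (2 * Real.pi * η)) ^ 2) :=
    (continuous_besselWeight N).measurable.mul
      ((continuous_absSymbol.measurable.mul (measurable_kSymbol hl)).pow_const 2)
  refine memLp_top_of_bound hm.aestronglyMeasurable ((2 * Real.pi) ^ 2 * D)
    (Eventually.of_forall fun η => ?_)
  have hp := besselWeight_pos N η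
  have hp2 := besselWeight_pos (-2) η
  rw [Real.norm_of_nonneg (by positivity), mul_pow]
  calc besselWeight N η * (absSymbol η ^ 2 * kSymbol l (2 * Real.pi * η) ^ 2)
      ≤ besselWeight N η * (((2 * Real.pi) ^ 2 * besselWeight (-2) η)
        * (D * besselWeight (-ρ) η)) := by
        gcongr
        · exact absSymbol_sq_le η
        · exact hk η
    _ = (2 * Real.pi) ^ 2 * D * besselWeight (N + -2 + -ρ) η := by
        rw [← besselWeight_mul, ← besselWeight_mul]; ring
    _ ≤ (2 * Real.pi) ^ 2 * D * 1 := by gcongr; exact besselWeight_le_one (by linarith) η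
    _ = _ := mul_one _

end Symbol

/-! ### Reduction to a Lipschitz nonlinearity -/

/-- A `C¹` function may be replaced by a globally Lipschitz one without changing its values and
those of its primitive on `[-M, M]`. -/
theorem exists_lipschitzWith_eqOn {g : ℝ → ℝ} (hg : ContDiff ℝ 1 g) (g0 : g 0 = 0) {M : ℝ}
    (hM : 0 ≤ M) : ∃ (c : ℝ≥0) (f : ℝ → ℝ), LipschitzWith c f ∧ f 0 = 0 ∧
      ∀ p, |p| ≤ M → f p = g p ∧ primitive f p = primitive g p := by
  obtain ⟨C, hC⟩ := (isCompact_Icc (a := -M) (b := M)).exists_bound_of_continuousOn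
    (hg.continuous_deriv le_rfl).continuousOn
  have hL : LipschitzOnWith C.toNNReal g (Icc (-M) M) :=
    (convex_Icc _ _).lipschitzOnWith_of_nnnorm_deriv_le
      (fun p _ => hg.differentiable one_ne_zero p) fun p hp => by
        rw [← norm_toNNReal]; exact Real.toNNReal_le_toNNReal (hC p hp)
  obtain ⟨f, hf, hfg⟩ := hL.extend_real
  have h0 : (0 : ℝ) ∈ Icc (-M) M := ⟨by linarith, hM⟩
  refine ⟨_, f, hf, (hfg h0).symm.trans g0, fun p hp => ⟨(hfg (abs_le.1 hp)).symm, ?_⟩⟩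
  refine intervalIntegral.integral_congr fun q hq => (hfg ?_).symm
  exact ordConnected_Icc.uIcc_subset h0 (abs_le.1 hp) hq

/-! ### Solutions on the Fourier side -/

theorem fourier_derivCLM_derivCLM_isFunction (f : L2C) :
    IsFunction (𝓕 (derivCLM ℂ (derivCLM ℂ (f : 𝓢'(ℝ, ℂ)))))
      (fun η => ((-absSymbol η ^ 2 : ℝ) : ℂ) * fourierL2 f η) := by
  rw [fourier_derivCLM_derivCLM, Lp.fourier_toTemperedDistribution_eq]
  refine isFunction_smulLeftCLM (isFunction_coe _) ?_
  simp only [absSymbol, sq_abs]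
  fun_prop

/-- A solution is a solution on the Fourier side on every compact time interval, for a globally
Lipschitz modification `f` of the nonlinearity `g` that agrees with it on the values of `u`. -/
theorem IsSolution.exists_isSpectralSolution {l : ℝ → ℝ} {ρ s : ℝ} {g : ℝ → ℝ} {φ : L2R}
    {ψ : 𝓢'(ℝ, ℂ)} {T : ℝ} {u : ℝ → L2R} {ut : ℝ → 𝓢'(ℝ, ℂ)} (hl : Measurable l)
    (hlρ : IsEllipticCoercive l ρ) (hρ : 2 ≤ ρ) (hs : 1 / 2 < s)
    (hu : IsSolution l ρ s g φ ψ T u ut) {r : ℝ} (hrT : r < T) {f : ℝ → ℝ} {c : ℝ≥0}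
    (hf : LipschitzWith c f) (f0 : f 0 = 0)
    (hfg : ∀ t ∈ Icc 0 r, ∀ᵐ x, f (u t x) = g (u t x)) :
    ∃ (w : ℝ → ℝ) (Y : ℝ → L2C) (C : ℝ),
      IsWaveSymbol (fun η => kSymbol l (2 * Real.pi * η)) w C ∧
      IsSpectralSolution (fun η => kSymbol l (2 * Real.pi * η)) w hf f0 u Y r ∧
      ∀ t ∈ Icc 0 r, IsFunction (𝓕 (ut t)) (fun η => w η • Y t η) := by
  obtain ⟨F₀, hF₀, hF₀u⟩ := hu.cont
  obtain ⟨F, F', hF', hF⟩ := hu.deriv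
  set σ : ℝ := s - 1 - ρ / 2 with hσ
  -- The weight `q = besselWeight N` is so large that `q û_t`, `q ξ² l û` and
  -- `q ξ² 𝓕 (g(u))` are all in `L²`.
  set N : ℝ := ρ + 2 + |σ| with hN
  have hNσ : 0 ≤ N + σ := by have := neg_abs_le σ; linarith
  have hN2 : ρ + 2 ≤ N := by have := abs_nonneg σ; linarith
  have hsub : Icc 0 r ⊆ Ico 0 T := fun t ht => ⟨ht.1, ht.2.trans_lt hrT⟩
  have hsub' : Ioo 0 r ⊆ Ico 0 T := Ioo_subset_Icc_self.trans hsub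
  have hww : ∀ M, IsAnnularSymbol (besselWeight M) := isAnnularSymbol_besselWeight
  set k : ℝ → ℝ := fun η => kSymbol l (2 * Real.pi * η) with hk
  obtain ⟨C, hC⟩ := hlρ.exists_isWaveSymbol hl hρ (hww (-N))
  set Y : ℝ → L2C := fun t => mulLp (besselWeight (N + σ)) (fourierL2 (F' t)) with hY
  have hYae : ∀ t, Y t =ᵐ[volume] fun η => besselWeight (N + σ) η • fourierL2 (F' t) η :=
    fun t => coeFn_mulLp (memLp_besselWeight hNσ) _
  have hUc : ContinuousOn (fun t => fourierR (u t)) (Icc 0 r) := by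
    have h1 : ContinuousOn (fun t => mulLp (besselWeight s) (fourierL2 (F₀ t))) (Icc 0 r) :=
      ((mulLp _).continuous.comp fourierL2.continuous).comp_continuousOn (hF₀.mono hsub)
    refine h1.congr fun t ht => Lp.ext ?_
    exact (fourierR_ae_eq_of_besselPotential_eq (hF₀u t (hsub ht))).trans
      (coeFn_mulLp (memLp_besselWeight (by linarith)) _).symm
  have huc : ContinuousOn u (Icc 0 r) := by
    have h1 : ContinuousOn (fun t => reL2 (fourierL2.symm (fourierR (u t)))) (Icc 0 r) :=
      (reL2.continuous.comp fourierL2.symm.continuous).comp_continuousOn hUc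
    exact h1.congr fun t _ => (reL2_symm_fourierR (u t)).symm
  have hYc : ContinuousOn Y (Icc 0 r) :=
    ((mulLp _).continuous.comp fourierL2.continuous).comp_continuousOn (hF'.mono hsub)
  have hUt : ∀ t ∈ Ico 0 T, IsFunction (𝓕 (ut t))
      (fun η => besselWeight σ η • fourierL2 (F' t) η) :=
    fun t ht => isFunction_fourier_of_besselPotential_eq (hF t ht).2.2
  have hm1 := hlρ.memLp_besselWeight_mul_sq hl hρ hN2
  have hm2 := memLp_besselWeight_mul_absSymbol_sq (N := N) (by linarith)
  set m1 : ℝ → ℝ := fun η => besselWeight N η * (absSymbol η * k η) ^ 2 with hm1def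
  set m2 : ℝ → ℝ := fun η => besselWeight N η * absSymbol η ^ 2 with hm2def
  have hm1' : IsAnnularSymbol m1 := by
    simp only [hm1def, sq]
    exact (hww N).mul (hC.symbol_freq.mul hC.symbol_freq)
  have hm2' : IsAnnularSymbol m2 := by
    simp only [hm2def, sq]
    exact (hww N).mul (isAnnularSymbol_absSymbol.mul isAnnularSymbol_absSymbol)
  set W : ℝ → L2C := fun t => -mulLp m1 (fourierR (u t)) - mulLp m2 (fourierComp hf f0 (u t))
    with hW
  have hWc : ContinuousOn W (Ioo 0 r) := by
    refine ContinuousOn.mono ?_ Ioo_subset_Icc_self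
    refine ContinuousOn.sub (ContinuousOn.neg ?_) ?_
    · exact (mulLp m1).continuous.comp_continuousOn hUc
    · exact ((mulLp m2).continuous.comp (continuous_fourierComp hf f0)).comp_continuousOn huc
  have hq := hasTemperateGrowth_besselWeight_ofReal N
  have hYd : ∀ t ∈ Ioo 0 r, HasDerivAt Y (W t) t := by
    refine hasDerivAt_of_forall_schwartz hWc fun χ t ht => ?_
    obtain ⟨Lu, gu, hLu, hgu, hd⟩ := hu.equation t ⟨ht.1, ht.2.trans hrT⟩
    set θ : 𝓢(ℝ, ℂ) := 𝓕 (SchwartzMap.smulLeftCLM ℂ (fun η => (besselWeight N η : ℂ)) χ) with hθ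
    have hleft : ∀ τ ∈ Ioo 0 r, (Y τ : 𝓢'(ℝ, ℂ)) χ = ut τ θ := by
      intro τ hτ
      have h1 := isFunction_smulLeftCLM (hUt τ (hsub' hτ)) hq
      rw [← h1.eq_coe (v := Y τ)]
      · rfl
      · filter_upwards [hYae τ] with η h2
        rw [h2, ← besselWeight_mul, mul_smul]
        simp
    have hLu' : smulLeftCLM ℂ (fun η => (besselWeight N η : ℂ)) (𝓕 Lu)
        = ((-mulLp m1 (fourierR (u t)) : L2C) : 𝓢'(ℝ, ℂ)) := by
      obtain ⟨H, hH1, hH2⟩ := hLu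
      have h1 := hH1.ae_eq (fourier_derivCLM_derivCLM_isFunction (ofRealL2 (u t)))
      refine (isFunction_smulLeftCLM hH2 hq).eq_coe ?_
      filter_upwards [h1, Lp.coeFn_neg (mulLp m1 (fourierR (u t))),
        coeFn_mulLp hm1 (fourierR (u t))] with η h2 h3 h4
      rw [h3, Pi.neg_apply, h4, h2]
      simp only [hm1def, hk, mul_pow, kSymbol, Real.sq_sqrt (hlρ.pos _).le, Complex.real_smul,
        fourierR]
      push_cast
      ring
    have hgu' : smulLeftCLM ℂ (fun η => (besselWeight N η : ℂ))
        (𝓕 (derivCLM ℂ (derivCLM ℂ gu)))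
        = ((-mulLp m2 (fourierComp hf f0 (u t)) : L2C) : 𝓢'(ℝ, ℂ)) := by
      have e : gu = ((ofRealL2 (hf.compLp f0 (u t)) : L2C) : 𝓢'(ℝ, ℂ)) := by
        refine hgu.eq_coe ?_
        filter_upwards [coeFn_ofRealL2 (hf.compLp f0 (u t)), hf.coeFn_compLp f0 (u t),
          hfg t (Ioo_subset_Icc_self ht)] with x h1 h2 h3
        rw [h1, h2, Function.comp_apply, h3]
      rw [e]
      refine (isFunction_smulLeftCLM (fourier_derivCLM_derivCLM_isFunction _) hq).eq_coe ?_
      filter_upwards [Lp.coeFn_neg (mulLp m2 (fourierComp hf f0 (u t))),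
        coeFn_mulLp hm2 (fourierComp hf f0 (u t))] with η h3 h4
      rw [h3, Pi.neg_apply, h4]
      simp only [hm2def, Complex.real_smul, fourierComp]
      push_cast
      ring
    have hright : (W t : 𝓢'(ℝ, ℂ)) χ = (Lu + derivCLM ℂ (derivCLM ℂ gu)) θ := by
      have h1 : (W t : 𝓢'(ℝ, ℂ)) = smulLeftCLM ℂ (fun η => (besselWeight N η : ℂ))
          (𝓕 (Lu + derivCLM ℂ (derivCLM ℂ gu))) := by
        rw [FourierTransform.fourier_add, map_add, hLu', hgu', hW]
        simp only [← Lp.toTemperedDistributionCLM_apply, sub_eq_add_neg, map_add]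
      rw [h1]
      rfl
    rw [hright]
    refine (hd θ).congr_of_eventuallyEq ?_
    filter_upwards [isOpen_Ioo.mem_nhds ht] with τ hτ
    exact hleft τ hτ
  refine ⟨besselWeight (-N), Y, C, hC, ⟨huc, hYc, fun n κ hκ t ht => ?_, fun n κ hκ t ht => ?_⟩,
    fun t ht => ?_⟩
  · have h1 : HasDerivAt (fun τ => trunc n (fun η => κ η * besselWeight σ η) (fourierL2 (F τ)))
        (trunc n (fun η => κ η * besselWeight σ η) (fourierL2 (F' t))) t :=
      ((trunc n _).comp
        fourierL2.toContinuousLinearEquiv.toContinuousLinearMap).hasFDerivAt.comp_hasDerivAt t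
        ((hF t (hsub' ht)).1.hasDerivAt (Ico_mem_nhds ht.1 (ht.2.trans hrT)))
    have e1 : trunc n (fun η => κ η * besselWeight (-N) η) (Y t)
        = trunc n (fun η => κ η * besselWeight σ η) (fourierL2 (F' t)) := by
      rw [trunc_of_ae_eq (hκ.mul (hww _)) (hww _) (hYae t)]
      simp only [mul_assoc, besselWeight_mul, neg_add_cancel_left]
    rw [e1]
    refine h1.congr_of_eventuallyEq ?_
    filter_upwards [isOpen_Ioo.mem_nhds ht] with τ hτ
    exact trunc_of_ae_eq hκ (hww σ)
      (fourierR_ae_eq_of_besselPotential_eq (hF τ (hsub' hτ)).2.1) n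
  · have h1 := (trunc n (fun η => κ η * besselWeight (-N) η)).hasFDerivAt.comp_hasDerivAt t
      (hYd t ht)
    refine h1.congr_deriv ?_
    have hκw := hκ.mul (hww (-N))
    have hinv : ∀ η, besselWeight (-N) η * besselWeight N η = 1 := fun η => by
      rw [besselWeight_mul, neg_add_cancel, besselWeight_zero]
    rw [hW]
    simp only [map_sub, map_neg]
    rw [trunc_of_ae_eq hκw hm1' (coeFn_mulLp hm1 _), trunc_of_ae_eq hκw hm2' (coeFn_mulLp hm2 _)]
    have e1 : (fun η => κ η * besselWeight (-N) η * m1 η)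
        = fun η => κ η * (absSymbol η * k η) ^ 2 := by
      ext η
      linear_combination (κ η * (absSymbol η * k η) ^ 2) * hinv η
    have e2 : (fun η => κ η * besselWeight (-N) η * m2 η)
        = fun η => κ η * absSymbol η ^ 2 := by
      ext η
      linear_combination (κ η * absSymbol η ^ 2) * hinv η
    rw [e1, e2]
  · refine (hUt t (hsub ht)).congr ?_
    filter_upwards [hYae t] with η h1
    rw [h1, smul_smul, besselWeight_mul, neg_add_cancel_left]

theorem lambdaSymbol_one (η : ℝ) : lambdaSymbol 1 (2 * Real.pi * η) = (absSymbol η)⁻¹ := by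
  rw [lambdaSymbol, Real.rpow_neg_one, absSymbol]

/-- If the Fourier transform of `f` is `F` and `B = m F` is in `L²`, then `m(D) f = 𝓕⁻¹ B`. -/
theorem isMultiplier_symm {m : ℝ → ℝ} {f : 𝓢'(ℝ, ℂ)} {F : ℝ → ℂ} (hf : IsFunction (𝓕 f) F)
    {B : L2C} (hB : B =ᵐ[volume] fun η => (m (2 * Real.pi * η) : ℂ) * F η) :
    IsMultiplier m f ((fourierL2.symm B : L2C) : 𝓢'(ℝ, ℂ)) := by
  refine ⟨F, hf, ?_⟩
  rw [Lp.fourier_toTemperedDistribution_eq, ← fourierL2_apply,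
    LinearIsometryEquiv.apply_symm_apply]
  exact (isFunction_coe B).congr hB

theorem IsMultiplier.fourierL2_ae_eq {m : ℝ → ℝ} {f : 𝓢'(ℝ, ℂ)} {v : L2C}
    (h : IsMultiplier m f (v : 𝓢'(ℝ, ℂ))) {F : ℝ → ℂ} (hf : IsFunction (𝓕 f) F) :
    fourierL2 v =ᵐ[volume] fun η => (m (2 * Real.pi * η) : ℂ) * F η := by
  obtain ⟨G, hG, hv⟩ := h
  rw [Lp.fourier_toTemperedDistribution_eq] at hv
  filter_upwards [(isFunction_coe _).ae_eq hv, hG.ae_eq hf] with η h1 h2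
  rw [fourierL2_apply, h1, h2]

/-- Conservation of energy between the times `0` and `r`. The potential energy is finite because `u`
is bounded and in `L²`, and `G(p) = O(p²)`. -/
theorem IsSolution.energy_eq {l : ℝ → ℝ} {ρ s : ℝ} {g : ℝ → ℝ} {φ : L2R} {ψ : 𝓢'(ℝ, ℂ)} {T : ℝ}
    {u : ℝ → L2R} {ut : ℝ → 𝓢'(ℝ, ℂ)} (hu : IsSolution l ρ s g φ ψ T u ut) (hl : Measurable l)
    (hlρ : IsEllipticCoercive l ρ) (hρ : 2 ≤ ρ) (hs : 1 / 2 < s) (hg : ContDiff ℝ 1 g)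
    (hg0 : g 0 = 0) (hψ : MultiplierMemL2 (lambdaSymbol 1) ψ)
    (hφ : MultiplierMemL2 (kSymbol l) (toDist φ)) {r : ℝ} (hr : r ∈ Ico 0 T) :
    MultiplierMemL2 (lambdaSymbol 1) (ut r) ∧ MultiplierMemL2 (kSymbol l) (toDist (u r)) ∧
      Integrable (fun x => primitive g (u r x)) ∧
      energy l g (u r) (ut r) = energy l g φ ψ := by
  have hsub : Icc 0 r ⊆ Ico 0 T := fun t ht => ⟨ht.1, ht.2.trans_lt hr.2⟩
  have h0 : (0 : ℝ) ∈ Icc 0 r := left_mem_Icc.2 hr.1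
  have hrr : r ∈ Icc 0 r := right_mem_Icc.2 hr.1
  -- By the Sobolev embedding, `u` is bounded on `[0, r]`.
  obtain ⟨F₀, hF₀, hF₀u⟩ := hu.cont
  obtain ⟨M₀, hM₀⟩ := isCompact_Icc.exists_bound_of_continuousOn (hF₀.mono hsub)
  have hM₀0 : 0 ≤ M₀ := (norm_nonneg _).trans (hM₀ 0 h0)
  set M := ‖(memLp_two_besselWeight hs).toLp‖ * M₀ with hM
  have hbd : ∀ t ∈ Icc 0 r, ∀ᵐ x, |u t x| ≤ M := by
    intro t ht
    filter_upwards [ae_abs_le_of_besselPotential_eq hs (hF₀u t (hsub ht))] with x hx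
    exact hx.trans (mul_le_mul_of_nonneg_left (hM₀ t ht) (norm_nonneg _))
  obtain ⟨c, f, hf, f0, hfg⟩ := exists_lipschitzWith_eqOn hg hg0 (M := M) (by positivity)
  have hprim : ∀ t ∈ Icc 0 r,
      (fun x => primitive f (u t x)) =ᵐ[volume] fun x => primitive g (u t x) := by
    intro t ht
    filter_upwards [hbd t ht] with x hx
    exact (hfg _ hx).2
  obtain ⟨w, Y, C, hC, hS, hV⟩ := hu.exists_isSpectralSolution hl hlρ hρ hs hr.2 hf f0
    fun t ht => (hbd t ht).mono fun x hx => (hfg _ hx).1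
  have hUf : ∀ t, IsFunction (𝓕 (toDist (u t))) (fourierR (u t)) := fun t => by
    rw [fourier_toDist]; exact isFunction_coe _
  obtain ⟨q, hq⟩ := hψ
  obtain ⟨p, hp⟩ := hφ
  rw [← hu.init] at hp ⊢
  rw [← hu.init_deriv] at hq ⊢
  have hA : fourierL2 p =ᵐ[volume] fun η => kSymbol l (2 * Real.pi * η) • fourierR (u 0) η := by
    simpa only [Complex.real_smul] using hp.fourierL2_ae_eq (hUf 0)
  have hB : fourierL2 q =ᵐ[volume] fun η => ((absSymbol η)⁻¹ * w η) • Y 0 η := by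
    filter_upwards [hq.fourierL2_ae_eq (hV 0 h0)] with η h1
    rw [h1, lambdaSymbol_one, mul_smul, Complex.real_smul, Complex.real_smul]
  obtain ⟨A', B', hA', hB', hE⟩ := hS.energy_eq hC hr.1 hA hB
  have hA'm : IsMultiplier (kSymbol l) (toDist (u r)) ((fourierL2.symm A' : L2C) : 𝓢'(ℝ, ℂ)) :=
    isMultiplier_symm (hUf r) (by simpa only [Complex.real_smul] using hA')
  have hB'm : IsMultiplier (lambdaSymbol 1) (ut r) ((fourierL2.symm B' : L2C) : 𝓢'(ℝ, ℂ)) := by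
    refine isMultiplier_symm (hV r hrr) ?_
    filter_upwards [hB'] with η h1
    rw [h1, lambdaSymbol_one, mul_smul, Complex.real_smul, Complex.real_smul]
  refine ⟨⟨_, hB'm⟩, ⟨_, hA'm⟩, (integrable_primitive hf f0 (u r)).congr (hprim r hrr), ?_⟩
  rw [energy, energy, multiplierNorm_eq hA'm, multiplierNorm_eq hB'm, multiplierNorm_eq hp,
    multiplierNorm_eq hq, LinearIsometryEquiv.norm_map, LinearIsometryEquiv.norm_map,
    ← integral_congr_ae (hprim r hrr), ← integral_congr_ae (hprim 0 h0), hE,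
    LinearIsometryEquiv.norm_map, LinearIsometryEquiv.norm_map]

end NonlocalWave

end

theorem theorem4p2 (l : ℝ → ℝ) (ρ s : ℝ) (g : ℝ → ℝ) (φ : NonlocalWave.L2R) (ψ : 𝓢'(ℝ, ℂ))
    (T : ℝ) (u : ℝ → NonlocalWave.L2R) (ut : ℝ → 𝓢'(ℝ, ℂ))
    (hl : Measurable l) (hlρ : NonlocalWave.IsEllipticCoercive l ρ)
    (hρ : 2 ≤ ρ) (hs : 1 / 2 < s)
    (hg : ContDiff ℝ (⌊s⌋₊ + 1 : ℕ) g) (hg0 : g 0 = 0)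
    (hT : 0 < T) (hu : NonlocalWave.IsSolution l ρ s g φ ψ T u ut)
    (hψ : NonlocalWave.MultiplierMemL2 (NonlocalWave.lambdaSymbol 1) ψ)
    (hφ : NonlocalWave.MultiplierMemL2 (NonlocalWave.kSymbol l) (NonlocalWave.toDist φ))
    (hG : Integrable (fun x => NonlocalWave.primitive g (φ x))) :
    ∀ t ∈ Set.Ico 0 T,
      NonlocalWave.MultiplierMemL2 (NonlocalWave.lambdaSymbol 1) (ut t) ∧
      NonlocalWave.MultiplierMemL2 (NonlocalWave.kSymbol l) (NonlocalWave.toDist (u t)) ∧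
      Integrable (fun x => NonlocalWave.primitive g (u t x)) ∧
      NonlocalWave.energy l g (u t) (ut t) = NonlocalWave.energy l g φ ψ := by
  intro t ht
  exact hu.energy_eq hl hlρ hρ hs (hg.of_le (by exact_mod_cast Nat.le_add_left 1 _)) hg0 hψ hφ ht
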